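/- Let $d,s,r\ge 1$ be integers and let $W^{s,\infty}([0,1]^d)$ be the space of functions whose weak derivatives $D^\alpha f$ with $|\alpha|\le s$ exist and are essentially bounded, with norm $\|f\|_{W^{s,\infty}}=\max_{|\alpha|\le s}\operatorname{ess\,sup}_{[0,1]^d}|D^\alpha f|$. A DLoR (diagonal plus low-rank) ReLU network of rank $r$ and width $N$, where $N\ge d$ and $N>r$, is a function $\mathbb R^d\to\mathbb R$ computed as follows. The input $x$ is padded by zeros to $z_0\in\mathbb R^N$; then $z_l=\sigma(M_lz_{l-1}+b_l)$ for $l=1,\dots,L-1$, where $\sigma(t)=\max(t,0)$ acts coordinatewise; the output is the first coordinate of $M_Lz_{L-1}+b_L$. Here $L\ge1$, all $b_l\in\mathbb R^N$, and every weight matrix has the form $M_l=\alpha_lI_N+U_lV_l^{T}$ with $\alpha_l\in\mathbb R$ and $U_l,V_l\in\mathbb R^{N\times r}$. Its total parameter count is $L(1+2Nr+N)$. **Theorem (Parameter Complexity for DLoR).** For every $B\ge 0$ there is a constant $C>0$, depending only on $d,s,r$ and $B$, such that for every $f\in W^{s,\infty}([0,1]^d)$ with $\|f\|_{W^{s,\infty}}\le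 B$ and every $\varepsilon>0$ there is a DLoR ReLU network $\Phi$ of rank $r$ that approximates $f$ uniformly to within $\varepsilon$, that is, $|f(x)-\Phi(x)|\le\varepsilon$ for almost every $x\in[0,1]^d$, and for every $x\in[0,1]^d$ if $f$ is the continuous representative of its class; moreover, if $\varepsilon\le 1/2$, the total parameter count of $\Phi$ is at most $C\,\varepsilon^{-d/s}\log(1/\varepsilon)$. -/

import Mathlib

open MeasureTheory
open scoped ENNReal NNReal

noncomputable section

namespace DLoR

/-! ### Sobolev spaces `W^{s,∞}([0,1]^d)` through weak derivatives -/

/-- The open unit cube `(0,1)^d`. -/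
def openCube (d : ℕ) : TopologicalSpace.Opens (Fin d → ℝ) :=
  ⟨Set.pi Set.univ fun _ => Set.Ioo (0 : ℝ) 1, isOpen_set_pi Set.finite_univ fun _ _ => isOpen_Ioo⟩

/-- Lebesgue measure on the unit cube (the boundary of the cube is a null set). -/
def cubeMeasure (d : ℕ) : Measure (Fin d → ℝ) :=
  volume.restrict (openCube d : Set (Fin d → ℝ))

/-- The iterated classical partial derivative `∂_{j 0} ⋯ ∂_{j (k-1)} φ` at `x`. Every derivative
`∂^α` with a multi-index `α`, `|α| = k`, is of this form. -/
def partialDeriv {d k : ℕ} (j : Fin k → Fin d) (φ : (Fin d → ℝ) → ℝ) (x : Fin d → ℝ) : ℝ :=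
  iteratedFDeriv ℝ k φ x fun i => Pi.single (j i) 1

/-- `g` is the weak derivative `∂_{j 0} ⋯ ∂_{j (k-1)} f` on the open unit cube: integration by parts
holds against all smooth functions with compact support in the cube. -/
def IsWeakDeriv {d k : ℕ} (j : Fin k → Fin d) (f g : (Fin d → ℝ) → ℝ) : Prop :=
  ∀ φ : TestFunction (openCube d) ℝ ⊤,
    ∫ x, f x * partialDeriv j φ x ∂(cubeMeasure d) =
      (-1) ^ k * ∫ x, g x * φ x ∂(cubeMeasure d)

/-- `f ∈ W^{s,∞}([0,1]^d)`: `f` and all its weak derivatives of order at most `s` exist and are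
essentially bounded on the cube. -/
def MemSobolev {d : ℕ} (s : ℕ) (f : (Fin d → ℝ) → ℝ) : Prop :=
  MemLp f ∞ (cubeMeasure d) ∧
    ∀ k ≤ s, ∀ j : Fin k → Fin d, ∃ g, MemLp g ∞ (cubeMeasure d) ∧ IsWeakDeriv j f g

/-- The norm of `W^{s,∞}([0,1]^d)`: the maximum, over all derivatives of order at most `s`, of the
essential supremum of the weak derivative. (A weak derivative is unique almost everywhere, so the
inner infimum ranges over copies of one number; it is `∞` if there is no weak derivative.) -/
def sobolevNorm {d : ℕ} (s : ℕ) (f : (Fin d → ℝ) → ℝ) : ℝ≥0∞ :=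
  ⨆ (k : ℕ) (_ : k ≤ s) (j : Fin k → Fin d),
    ⨅ (g : (Fin d → ℝ) → ℝ) (_ : MemLp g ∞ (cubeMeasure d)) (_ : IsWeakDeriv j f g),
      eLpNorm g ∞ (cubeMeasure d)

/-! ### Networks with diagonal plus low-rank weights -/

/-- The parameters of a layer of width `N` whose weight matrix is a diagonal plus low-rank component
of rank `r`: the scalar `α`, the factors `U` and `V`, and the bias `b`. -/
structure Layer (N r : ℕ) where
  α : ℝ
  U : Matrix (Fin N) (Fin r) ℝ
  V : Matrix (Fin N) (Fin r) ℝ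
  b : Fin N → ℝ

/-- The weight matrix `α I + U Vᵀ`. -/
def Layer.weight {N r : ℕ} (l : Layer N r) : Matrix (Fin N) (Fin N) ℝ :=
  l.α • (1 : Matrix (Fin N) (Fin N) ℝ) + l.U * l.V.transpose

/-- The affine map `z ↦ (α I + U Vᵀ) z + b`. -/
def Layer.affine {N r : ℕ} (l : Layer N r) (z : Fin N → ℝ) : Fin N → ℝ :=
  l.weight.mulVec z + l.b

/-- The number of real parameters of one layer: one for `α`, `N r` for each of `U` and `V`, and `N`
for the bias. -/
def Layer.paramCount {N r : ℕ} (_ : Layer N r) : ℕ :=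
  1 + N * r + N * r + N

/-- A feedforward network with inputs in `ℝ^d`, real outputs and a constant width, all of whose
weight matrices are diagonal plus rank-`r` components, with `r` smaller than the width.
The list `hidden` starts with the layer that is applied first. -/
structure Network (d r : ℕ) where
  width : ℕ
  input_le : d ≤ width
  rank_lt : r < width
  hidden : List (Layer width r)
  output : Layer width r

/-- Padding of the input by zeros to the width `N` of a network. -/
def pad {d : ℕ} (N : ℕ) (x : Fin d → ℝ) : Fin N → ℝ :=
  fun i => if h : (i : ℕ) < d then x ⟨i, h⟩ else 0

/-- The function computed by a network with activation `ρ`: the input is padded by zeros, every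
hidden layer is the affine map followed by `ρ` in each coordinate, the output layer has no
activation, and the first coordinate of its value is the output. -/
def Network.eval {d r : ℕ} (ρ : ℝ → ℝ) (net : Network d r) (x : Fin d → ℝ) : ℝ :=
  net.output.affine
    (net.hidden.foldl (fun z l => fun i => ρ (l.affine z i)) (pad net.width x))
    ⟨0, Nat.zero_lt_of_lt net.rank_lt⟩

/-- The total number of real parameters of a network. -/
def Network.paramCount {d r : ℕ} (net : Network d r) : ℕ :=
  (net.hidden.map Layer.paramCount).sum + net.output.paramCount

/-- The rectified linear unit. -/
def relu (t : ℝ) : ℝ := max t 0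

end DLoR

end

/-!
The proof compiles a piecewise polynomial approximation of `f` into a program for a register machine
with a fixed number of registers, and executes each instruction by one layer of rank one.

*Layers as instructions.* If all coordinates of a state `z` are non-negative, then the layer with
weight matrix `I + e_t (v - e_t)ᵀ` and bias `c e_t` replaces `z_t` by `relu (⟨v, z⟩ + c)` and keeps
every other coordinate (`Instr.relu_toLayer_affine`). Hence a network of constant width and rank `1`
runs any straight-line program with such instructions, and its size is proportional to the length of
the program; the rank `r` and the width only enter the constant. Numbers of both signs are avoided by
accumulating the positive and the negative terms of a sum in two registers.

*Products.* Squares on `[0,1]` are approximated to within `4^{-m-1}` by sums of `m` iterated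
sawtooth functions, which are computed in place by `3 m + 1` instructions; polarisation gives
products (`abs_mulApprox_sub_le`, `run_mulProgram`). So a sum of `T` products of at most `k` factors
which are piecewise linear functions of one coordinate costs `O(T k m)` parameters
(`exists_network_of_terms`).

*Local polynomials.* The mollifications of `f` are smooth, and inside the cube their derivatives up
to order `s` are bounded by essential bounds of the weak derivatives of `f`
(`abs_partialDeriv_mollify_le`). Taylor's formula and a compactness argument for the Taylor
coefficients yield, at every point `b` of the closed cube, a polynomial of degree less than `s` with
bounded coefficients which differs from `f` by
`O(|x - b|^s)` for almost every `x` (`exists_local_polynomial`).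

*Conclusion.* The local polynomials at the points of a grid of mesh `1/n` are averaged with hat
functions, which form a partition of unity. The polynomial of a cell is centred at the lower corner
of the support of its hat function, so that it is a combination of products of the non-negative
functions `max 0 (x_i - b_i)`. The error is `O(n^{-s})` from the polynomials plus `O(n^d 4^{-m})`
from the products (`exists_network_of_grid`). With `n ≈ ε^{-1/s}` and `m ≈ log (1/ε)` both are at
most `ε / 2` (`exists_grid_parameters`), and there are `O(n^d)` terms.
-/

noncomputable section

namespace DLoR

open scoped Convolution ContDiff Topology

/-! ### Partial derivatives, convolutions and Taylor expansions -/

section Calculus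

variable {d : ℕ}

theorem contDiff_partialDeriv {k : ℕ} (j : Fin k → Fin d) {φ : (Fin d → ℝ) → ℝ}
    (hφ : ContDiff ℝ ∞ φ) : ContDiff ℝ ∞ (partialDeriv j φ) := by
  have h : ContDiff ℝ ∞ (iteratedFDeriv ℝ k φ) :=
    hφ.iteratedFDeriv_right (m := ∞) (i := k) (by exact_mod_cast le_top)
  exact (ContinuousMultilinearMap.apply ℝ (fun _ : Fin k => (Fin d → ℝ)) ℝ
    (fun i => Pi.single (j i) 1)).contDiff.comp h

theorem partialDeriv_succ {k : ℕ} (j : Fin (k + 1) → Fin d) {φ : (Fin d → ℝ) → ℝ}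
    (hφ : ContDiff ℝ ∞ φ) (x : Fin d → ℝ) :
    partialDeriv j φ x = fderiv ℝ (partialDeriv (Fin.tail j) φ) x (Pi.single (j 0) 1) := by
  have h : Differentiable ℝ (iteratedFDeriv ℝ k φ) :=
    hφ.differentiable_iteratedFDeriv (by exact_mod_cast ENat.natCast_lt_top k)
  exact (h x).iteratedFDeriv_succ_apply_left'

theorem hasCompactSupport_partialDeriv {k : ℕ} (j : Fin k → Fin d) {φ : (Fin d → ℝ) → ℝ}
    (hc : HasCompactSupport φ) : HasCompactSupport (partialDeriv j φ) :=
  (hc.iteratedFDeriv (𝕜 := ℝ) k).comp_left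
    (g := fun T : ContinuousMultilinearMap ℝ (fun _ : Fin k => (Fin d → ℝ)) ℝ =>
      T fun i => Pi.single (j i) 1) rfl

/-- All derivatives of a convolution with a smooth function may be put on that function. -/
theorem partialDeriv_convolution {k : ℕ} (j : Fin k → Fin d) {f φ : (Fin d → ℝ) → ℝ}
    (hf : LocallyIntegrable f) (hφ : ContDiff ℝ ∞ φ) (hc : HasCompactSupport φ) :
    partialDeriv j (f ⋆[ContinuousLinearMap.mul ℝ ℝ] φ) =
      f ⋆[ContinuousLinearMap.mul ℝ ℝ] partialDeriv j φ := by
  have hconv : ContDiff ℝ ∞ (f ⋆[ContinuousLinearMap.mul ℝ ℝ] φ) :=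
    hc.contDiff_convolution_right _ hf hφ
  induction k with
  | zero => ext x; simp [partialDeriv, MeasureTheory.convolution]
  | succ k ih =>
    ext x
    have h1 := contDiff_partialDeriv (Fin.tail j) hφ
    have h2 := hasCompactSupport_partialDeriv (Fin.tail j) hc
    rw [partialDeriv_succ j hconv, ih,
      (h2.hasFDerivAt_convolution_right _ hf (h1.of_le (by exact_mod_cast le_top)) x).fderiv,
      convolution_precompR_apply _ hf (h2.fderiv ℝ) (h1.continuous_fderiv (by simp))]
    congr 1
    ext y
    exact (partialDeriv_succ j hφ y).symm

theorem partialDeriv_comp_const_sub {k : ℕ} (j : Fin k → Fin d) {φ : (Fin d → ℝ) → ℝ}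
    (hφ : ContDiff ℝ ∞ φ) (x y : Fin d → ℝ) :
    partialDeriv j (fun z => φ (x - z)) y = (-1) ^ k * partialDeriv j φ (x - y) := by
  have h1 : (fun z => φ (x - z)) =
      (fun z => φ (x + z)) ∘ (-ContinuousLinearMap.id ℝ (Fin d → ℝ)) := by
    ext z; simp [sub_eq_add_neg]
  have h2 : ContDiff ℝ ∞ (fun z => φ (x + z)) := hφ.comp (contDiff_const.add contDiff_id)
  unfold partialDeriv
  rw [h1, ContinuousLinearMap.iteratedFDeriv_comp_right _ h2 y (by exact_mod_cast le_top),
    ContinuousMultilinearMap.compContinuousLinearMap_apply, iteratedFDeriv_comp_add_left]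
  have h3 := (iteratedFDeriv ℝ k φ (x - y)).map_smul_univ (fun _ => (-1 : ℝ))
    (fun i => Pi.single (j i) 1)
  simpa [sub_eq_add_neg] using h3

theorem iteratedFDeriv_apply_diag (F : (Fin d → ℝ) → ℝ) (k : ℕ) (x v : Fin d → ℝ) :
    iteratedFDeriv ℝ k F x (fun _ => v) =
      ∑ j : Fin k → Fin d, (∏ l, v (j l)) * partialDeriv j F x := by
  have hv : (fun _ : Fin k => v) = fun _ => ∑ i, v i • (Pi.single i 1 : Fin d → ℝ) := by
    funext _
    exact pi_eq_sum_univ' v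
  rw [hv, ContinuousMultilinearMap.map_sum]
  refine Finset.sum_congr rfl fun j _ => ?_
  rw [ContinuousMultilinearMap.map_smul_univ, smul_eq_mul, partialDeriv]

theorem iteratedDeriv_comp_line {F : (Fin d → ℝ) → ℝ} (hF : ContDiff ℝ ∞ F) (k : ℕ)
    (a v : Fin d → ℝ) (t : ℝ) :
    iteratedDeriv k (fun t : ℝ => F (a + t • v)) t =
      ∑ j : Fin k → Fin d, (∏ l, v (j l)) * partialDeriv j F (a + t • v) := by
  have h1 : (fun t : ℝ => F (a + t • v)) =
      (fun z => F (a + z)) ∘ (ContinuousLinearMap.toSpanSingleton ℝ v) := by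
    ext z; simp
  have h2 : ContDiff ℝ ∞ (fun z => F (a + z)) := hF.comp (contDiff_const.add contDiff_id)
  rw [iteratedDeriv_eq_iteratedFDeriv, h1,
    ContinuousLinearMap.iteratedFDeriv_comp_right _ h2 t (by exact_mod_cast le_top),
    ContinuousMultilinearMap.compContinuousLinearMap_apply, iteratedFDeriv_comp_add_left]
  simp [iteratedFDeriv_apply_diag]

theorem abs_sum_prod_mul_le {k : ℕ} {v : Fin d → ℝ} {c : (Fin k → Fin d) → ℝ} {M : ℝ}
    (hc : ∀ j, |c j| ≤ M) :
    |∑ j : Fin k → Fin d, (∏ l, v (j l)) * c j| ≤ M * d ^ k * ‖v‖ ^ k := by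
  calc |∑ j : Fin k → Fin d, (∏ l, v (j l)) * c j|
      ≤ ∑ j : Fin k → Fin d, ‖v‖ ^ k * M := by
        refine (Finset.abs_sum_le_sum_abs _ _).trans (Finset.sum_le_sum fun j _ => ?_)
        rw [abs_mul, Finset.abs_prod]
        refine mul_le_mul ?_ (hc j) (abs_nonneg _) (by positivity)
        calc ∏ l, |v (j l)| ≤ ∏ _l : Fin k, ‖v‖ :=
              Finset.prod_le_prod (fun _ _ => abs_nonneg _) fun l _ => norm_le_pi_norm v (j l)
          _ = ‖v‖ ^ k := by simp
    _ = M * d ^ k * ‖v‖ ^ k := by simp; ring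

/-- Taylor's formula of order `s` along a segment, with the derivatives of order `k` written as
sums over all sequences of `k` coordinate directions. -/
theorem abs_sub_taylor_le {s : ℕ} (hs : 1 ≤ s) {F : (Fin d → ℝ) → ℝ} (hF : ContDiff ℝ ∞ F)
    (a v : Fin d → ℝ) {M : ℝ}
    (hM : ∀ t ∈ Set.Icc (0 : ℝ) 1, ∀ j : Fin s → Fin d, |partialDeriv j F (a + t • v)| ≤ M) :
    |F (a + v) - ∑ k ∈ Finset.range s, ∑ j : Fin k → Fin d,
      ((k.factorial : ℝ)⁻¹ * partialDeriv j F a) * ∏ l, v (j l)| ≤ M * d ^ s * ‖v‖ ^ s := by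
  obtain ⟨n, rfl⟩ : ∃ n, s = n + 1 := ⟨s - 1, by omega⟩
  set h : ℝ → ℝ := fun t => F (a + t • v) with hh
  have hsm : ContDiff ℝ ∞ h := hF.comp (contDiff_const.add (contDiff_id.smul contDiff_const))
  have hw : ∀ k : ℕ, ∀ t ∈ Set.Icc (0 : ℝ) 1, iteratedDerivWithin k h (Set.Icc 0 1) t =
      ∑ j : Fin k → Fin d, (∏ l, v (j l)) * partialDeriv j F (a + t • v) := by
    intro k t ht
    rw [iteratedDerivWithin_eq_iteratedDeriv (uniqueDiffOn_Icc zero_lt_one)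
      ((hsm.of_le (by exact_mod_cast le_top)).contDiffAt) ht, hh, iteratedDeriv_comp_line hF]
  have key := taylor_mean_remainder_bound (f := h) (a := 0) (b := 1) (x := 1) (n := n)
    (C := M * d ^ (n + 1) * ‖v‖ ^ (n + 1)) zero_le_one
    (hsm.of_le (by exact_mod_cast le_top)).contDiffOn (by simp) (by
      intro t ht
      rw [hw _ t ht]
      exact abs_sum_prod_mul_le (hM t ht))
  -- The bound `M` may be negative only if `d = 0`, when the products below vanish.
  have hC : 0 ≤ M * d ^ (n + 1) * ‖v‖ ^ (n + 1) := by
    have := key.trans' (norm_nonneg _)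
    by_contra hneg
    have h2 : M * d ^ (n + 1) * ‖v‖ ^ (n + 1) * (1 - 0) ^ (n + 1) / (n.factorial : ℝ) < 0 := by
      rw [sub_zero, one_pow, mul_one]
      exact div_neg_of_neg_of_pos (not_le.mp hneg) (by positivity)
    linarith
  have hle : M * d ^ (n + 1) * ‖v‖ ^ (n + 1) * (1 - 0) ^ (n + 1) / (n.factorial : ℝ) ≤
      M * d ^ (n + 1) * ‖v‖ ^ (n + 1) := by
    rw [sub_zero, one_pow, mul_one]
    exact div_le_self hC (by exact_mod_cast Nat.one_le_iff_ne_zero.mpr (Nat.factorial_ne_zero n))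
  refine le_trans (le_of_eq ?_) (key.trans hle)
  rw [Real.norm_eq_abs, taylor_within_apply]
  congr 2
  · simp [hh]
  · refine Finset.sum_congr rfl fun k _ => ?_
    rw [hw k 0 (by simp), smul_eq_mul, Finset.mul_sum]
    refine Finset.sum_congr rfl fun j _ => ?_
    simp
    ring

end Calculus

/-! ### Mollification of Sobolev functions -/

section Mollification

variable {d : ℕ}

theorem measurableSet_openCube : MeasurableSet (openCube d : Set (Fin d → ℝ)) :=
  (openCube d).isOpen.measurableSet

theorem openCube_subset_Icc : (openCube d : Set (Fin d → ℝ)) ⊆ Set.Icc 0 1 := by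
  intro x hx
  have h : ∀ i, x i ∈ Set.Ioo (0 : ℝ) 1 := fun i => hx i (Set.mem_univ i)
  exact ⟨fun i => (h i).1.le, fun i => (h i).2.le⟩

instance isFiniteMeasure_cubeMeasure : IsFiniteMeasure (cubeMeasure d) :=
  ⟨by
    rw [cubeMeasure, Measure.restrict_apply_univ]
    exact (measure_mono openCube_subset_Icc).trans_lt isCompact_Icc.measure_lt_top⟩

/-- The extension of `f` from the open unit cube by zero. -/
def zeroExtend (f : (Fin d → ℝ) → ℝ) : (Fin d → ℝ) → ℝ :=
  (openCube d : Set (Fin d → ℝ)).indicator f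

theorem locallyIntegrable_zeroExtend {f : (Fin d → ℝ) → ℝ} (hf : MemLp f ∞ (cubeMeasure d)) :
    LocallyIntegrable (zeroExtend f) := by
  have h : Integrable f (cubeMeasure d) := hf.integrable le_top
  exact ((integrable_indicator_iff measurableSet_openCube).mpr h).locallyIntegrable

/-- Inside the cube, the derivatives of a mollification are averages of the weak derivatives. -/
theorem abs_partialDeriv_mollify_le {k : ℕ} {j : Fin k → Fin d} {f g : (Fin d → ℝ) → ℝ}
    (hf : MemLp f ∞ (cubeMeasure d)) (hfg : IsWeakDeriv j f g)
    {M : ℝ≥0} (hM : eLpNorm g ∞ (cubeMeasure d) ≤ M) (φ : ContDiffBump (0 : Fin d → ℝ))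
    {x : Fin d → ℝ} (hx : Metric.closedBall x φ.rOut ⊆ (openCube d : Set (Fin d → ℝ))) :
    |partialDeriv j (zeroExtend f ⋆[ContinuousLinearMap.mul ℝ ℝ] φ.normed volume) x| ≤ M := by
  set ρ := φ.normed volume with hρ
  have hρs : ContDiff ℝ ∞ ρ := φ.contDiff_normed
  have hρc : HasCompactSupport ρ := φ.hasCompactSupport_normed
  have hsub : ContDiff ℝ ∞ fun y => ρ (x - y) := hρs.comp (contDiff_const.sub contDiff_id)
  have hts : tsupport (fun y => ρ (x - y)) ⊆ Metric.closedBall x φ.rOut := by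
    refine closure_minimal (fun y hy => ?_) Metric.isClosed_closedBall
    have : x - y ∈ Function.support ρ := hy
    rw [hρ, φ.support_normed_eq] at this
    rw [Metric.mem_closedBall, dist_comm, dist_eq_norm]
    exact (mem_ball_zero_iff.mp this).le
  let ψ : TestFunction (openCube d) ℝ ⊤ :=
    { toFun := fun y => ρ (x - y)
      contDiff' := hsub
      hasCompactSupport' := HasCompactSupport.of_support_subset_isCompact
        (isCompact_closedBall x φ.rOut) ((subset_tsupport _).trans hts)
      tsupport_subset' := hts.trans hx }
  have hψ : ∀ y, ψ y = ρ (x - y) := fun _ => rfl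
  have hψ' : ⇑ψ = fun y => ρ (x - y) := rfl
  have hint : Integrable (fun y => ρ (x - y)) volume :=
    (hsub.continuous).integrable_of_hasCompactSupport ψ.hasCompactSupport
  have key := hfg ψ
  have e1 : partialDeriv j (zeroExtend f ⋆[ContinuousLinearMap.mul ℝ ℝ] ρ) x =
      ∫ y, g y * ψ y ∂(cubeMeasure d) := by
    rw [partialDeriv_convolution j (locallyIntegrable_zeroExtend hf) hρs hρc]
    have h1 : (zeroExtend f ⋆[ContinuousLinearMap.mul ℝ ℝ] partialDeriv j ρ) x =
        ∫ y, f y * partialDeriv j ρ (x - y) ∂(cubeMeasure d) := by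
      rw [cubeMeasure, ← integral_indicator measurableSet_openCube]
      simp only [MeasureTheory.convolution, ContinuousLinearMap.mul_apply', zeroExtend]
      congr 1
      ext y
      by_cases hy : y ∈ (openCube d : Set (Fin d → ℝ)) <;> simp [hy]
    have h2 : ∫ y, f y * partialDeriv j ψ y ∂(cubeMeasure d) =
        (-1) ^ k * ∫ y, f y * partialDeriv j ρ (x - y) ∂(cubeMeasure d) := by
      rw [← integral_const_mul]
      congr 1
      ext y
      rw [hψ', partialDeriv_comp_const_sub j hρs]
      ring
    rw [h2] at key
    rw [h1]
    exact mul_left_cancel₀ (pow_ne_zero k (by norm_num)) key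
  rw [e1, ← Real.norm_eq_abs]
  have hg : ∀ᵐ y ∂(cubeMeasure d), ‖g y * ψ y‖ ≤ M * ρ (x - y) := by
    have hle : ∀ᵐ y ∂(cubeMeasure d), ‖g y‖ₑ ≤ eLpNormEssSup g (cubeMeasure d) :=
      ae_le_eLpNormEssSup
    filter_upwards [hle] with y hy
    rw [eLpNorm_exponent_top] at hM
    have h3 : ‖g y‖₊ ≤ M := by exact_mod_cast hy.trans hM
    rw [norm_mul, hψ, Real.norm_of_nonneg (φ.nonneg_normed _)]
    exact mul_le_mul_of_nonneg_right (by exact_mod_cast h3) (φ.nonneg_normed _)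
  calc ‖∫ y, g y * ψ y ∂(cubeMeasure d)‖ ≤ ∫ y, M * ρ (x - y) ∂(cubeMeasure d) :=
        norm_integral_le_of_norm_le ((hint.const_mul _).restrict) hg
    _ ≤ ∫ y, M * ρ (x - y) := by
        refine setIntegral_le_integral (hint.const_mul _) (Filter.Eventually.of_forall fun y => ?_)
        exact mul_nonneg M.2 (φ.nonneg_normed _)
    _ = M := by
        rw [integral_const_mul, integral_sub_left_eq_self ρ volume x, hρ, φ.integral_normed,
          mul_one]

end Mollification

/-! ### Local polynomial approximation of Sobolev functions -/

section LocalPolynomials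

variable {d : ℕ}

/-- The exponents of a polynomial of degree less than `s` in `d` variables: the sequence
`j : Fin k → Fin d` stands for the monomial `∏ l, x (j l)`, so a monomial may occur repeatedly. -/
abbrev MonomialIndex (d s : ℕ) : Type := (k : Fin s) × (Fin k → Fin d)

/-- The summand `1` replaces the uniqueness of weak derivatives: the infimum in the Sobolev norm
need not be attained a priori. -/
theorem exists_weakDeriv_of_sobolevNorm_le {s : ℕ} {f : (Fin d → ℝ) → ℝ} {B : ℝ≥0}
    (hB : sobolevNorm s f ≤ B) {k : ℕ} (hk : k ≤ s) (j : Fin k → Fin d) :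
    ∃ g, IsWeakDeriv j f g ∧ eLpNorm g ∞ (cubeMeasure d) ≤ (B + 1 : ℝ≥0) := by
  have h1 : (⨅ (g : (Fin d → ℝ) → ℝ) (_ : MemLp g ∞ (cubeMeasure d)) (_ : IsWeakDeriv j f g),
      eLpNorm g ∞ (cubeMeasure d)) ≤ B := by
    refine le_trans ?_ hB
    unfold sobolevNorm
    exact le_iSup_of_le k (le_iSup_of_le hk (le_iSup_of_le j le_rfl))
  have h2 : (B : ℝ≥0∞) < (B + 1 : ℝ≥0) := by
    exact_mod_cast lt_add_one B
  obtain ⟨g, hg⟩ := iInf_lt_iff.mp (h1.trans_lt h2)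
  obtain ⟨_, hg⟩ := iInf_lt_iff.mp hg
  obtain ⟨hw, hg⟩ := iInf_lt_iff.mp hg
  exact ⟨g, hw, hg.le⟩

theorem closedBall_subset_openCube {η : ℝ} (hη : 0 < η) {y : Fin d → ℝ}
    (hy : ∀ i, y i ∈ Set.Icc (2 * η) (1 - 2 * η)) :
    Metric.closedBall y η ⊆ (openCube d : Set (Fin d → ℝ)) := by
  intro z hz i _
  have h1 : |z i - y i| ≤ η := by
    rw [← Real.dist_eq]
    exact (dist_le_pi_dist z y i).trans hz
  obtain ⟨h2, h3⟩ := abs_le.mp h1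
  obtain ⟨h4, h5⟩ := hy i
  constructor <;> linarith

/-- A bump function at the origin with support of radius `1 / (4 (i + 1))`. -/
def mollifier (d i : ℕ) : ContDiffBump (0 : Fin d → ℝ) where
  rIn := 1 / (4 * ((i : ℝ) + 1)) / 2
  rOut := 1 / (4 * ((i : ℝ) + 1))
  rIn_pos := by positivity
  rIn_lt_rOut := half_lt_self (by positivity)

theorem tendsto_mollifier_rOut :
    Filter.Tendsto (fun i => (mollifier d i).rOut) Filter.atTop (𝓝 0) := by
  have h : Filter.Tendsto (fun i : ℕ => (1 / 4 : ℝ) * (1 / ((i : ℝ) + 1))) Filter.atTop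
      (𝓝 (1 / 4 * 0)) := tendsto_one_div_add_atTop_nhds_zero_nat.const_mul _
  rw [mul_zero] at h
  refine h.congr fun i => ?_
  simp only [mollifier]
  field_simp

theorem mollifier_rOut_le (i : ℕ) : (mollifier d i).rOut ≤ 1 / 4 := by
  simp only [mollifier]
  exact one_div_le_one_div_of_le (by norm_num) (by linarith [(Nat.cast_nonneg i : (0 : ℝ) ≤ i)])

theorem ae_tendsto_mollify {f : (Fin d → ℝ) → ℝ} (hf : MemLp f ∞ (cubeMeasure d)) :
    ∀ᵐ x ∂(cubeMeasure d), Filter.Tendsto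
      (fun i => (zeroExtend f ⋆[ContinuousLinearMap.mul ℝ ℝ] (mollifier d i).normed volume) x)
      Filter.atTop (𝓝 (f x)) := by
  have h := ContDiffBump.ae_convolution_tendsto_right_of_locallyIntegrable (K := 2)
    (φ := mollifier d) (l := Filter.atTop) (μ := volume) tendsto_mollifier_rOut
    (Filter.Eventually.of_forall fun i => by simp only [mollifier]; linarith)
    (locallyIntegrable_zeroExtend hf)
  have hmem : ∀ᵐ x ∂(cubeMeasure d), x ∈ (openCube d : Set (Fin d → ℝ)) :=
    ae_restrict_mem measurableSet_openCube
  have hL : (ContinuousLinearMap.lsmul ℝ ℝ : ℝ →L[ℝ] ℝ →L[ℝ] ℝ).flip =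
      ContinuousLinearMap.mul ℝ ℝ := by
    ext; simp
  filter_upwards [ae_restrict_of_ae h, hmem] with x hx hxm
  rw [zeroExtend, Set.indicator_of_mem hxm] at hx
  refine hx.congr fun i => ?_
  rw [← hL, convolution_flip]
  rfl

/-- A function in `W^{s,∞}` is approximated to order `s` at every point `b` of the closed cube by
a polynomial of degree less than `s` with bounded coefficients. The coefficients are limit points
of the Taylor coefficients of the mollifications of `f` at interior points tending to `b`. -/
theorem exists_local_polynomial {s : ℕ} (hs : 1 ≤ s) {f : (Fin d → ℝ) → ℝ} {B : ℝ≥0}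
    (hf : MemSobolev s f) (hB : sobolevNorm s f ≤ B) :
    ∃ c : (Fin d → ℝ) → MonomialIndex d s → ℝ,
      (∀ b ∈ Set.Icc (0 : Fin d → ℝ) 1, ∀ q, |c b q| ≤ B + 1) ∧
      ∀ᵐ x ∂(cubeMeasure d), ∀ b ∈ Set.Icc (0 : Fin d → ℝ) 1,
        |f x - ∑ q, c b q * ∏ l, (x (q.2 l) - b (q.2 l))| ≤ (B + 1) * d ^ s * ‖x - b‖ ^ s := by
  set F : ℕ → (Fin d → ℝ) → ℝ := fun i =>
    zeroExtend f ⋆[ContinuousLinearMap.mul ℝ ℝ] (mollifier d i).normed volume with hF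
  set η : ℕ → ℝ := fun i => (mollifier d i).rOut with hη
  have hη0 : ∀ i, 0 < η i := fun i => (mollifier d i).rOut_pos
  have hη1 : ∀ i, η i ≤ 1 / 4 := mollifier_rOut_le
  have hFs : ∀ i, ContDiff ℝ ∞ (F i) := fun i =>
    (mollifier d i).hasCompactSupport_normed.contDiff_convolution_right _
      (locallyIntegrable_zeroExtend hf.1) (mollifier d i).contDiff_normed
  have hFb : ∀ i, ∀ y : Fin d → ℝ, (∀ l, y l ∈ Set.Icc (2 * η i) (1 - 2 * η i)) →
      ∀ k ≤ s, ∀ j : Fin k → Fin d, |partialDeriv j (F i) y| ≤ (B : ℝ) + 1 := by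
    intro i y hy k hk j
    obtain ⟨g, hg, hgB⟩ := exists_weakDeriv_of_sobolevNorm_le hB hk j
    exact_mod_cast abs_partialDeriv_mollify_le hf.1 hg hgB (mollifier d i)
      (closedBall_subset_openCube (hη0 i) hy)
  -- `T i` contracts the cube to the points at which the mollification `F i` is controlled.
  set T : ℕ → (Fin d → ℝ) → (Fin d → ℝ) := fun i b l => 2 * η i + (1 - 4 * η i) * b l with hT
  have hTm : ∀ i, ∀ b ∈ Set.Icc (0 : Fin d → ℝ) 1, ∀ l,
      T i b l ∈ Set.Icc (2 * η i) (1 - 2 * η i) := by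
    intro i b hb l
    have h0 : 0 ≤ b l := hb.1 l
    have h1 : b l ≤ 1 := hb.2 l
    have h4 := hη1 i
    constructor
    · have : 0 ≤ (1 - 4 * η i) * b l := mul_nonneg (by linarith) h0
      simp only [hT]; linarith
    · have : (1 - 4 * η i) * b l ≤ (1 - 4 * η i) * 1 :=
        mul_le_mul_of_nonneg_left h1 (by linarith)
      simp only [hT]; linarith
  set cs : ℕ → (Fin d → ℝ) → MonomialIndex d s → ℝ := fun i b q =>
    ((q.1 : ℕ).factorial : ℝ)⁻¹ * partialDeriv q.2 (F i) (T i b) with hcs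
  have hcsb : ∀ i, ∀ b ∈ Set.Icc (0 : Fin d → ℝ) 1, ∀ q, |cs i b q| ≤ B + 1 := by
    intro i b hb q
    have h1 := hFb i (T i b) (hTm i b hb) q.1 q.1.2.le q.2
    have h2 : ((q.1 : ℕ).factorial : ℝ)⁻¹ ≤ 1 :=
      inv_le_one_of_one_le₀
        (by exact_mod_cast Nat.one_le_iff_ne_zero.mpr (Nat.factorial_ne_zero _))
    rw [hcs, abs_mul, abs_of_nonneg (by positivity)]
    calc _ ≤ 1 * ((B : ℝ) + 1) := mul_le_mul h2 h1 (abs_nonneg _) zero_le_one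
      _ = B + 1 := one_mul _
  have hlim : ∀ b : Fin d → ℝ, ∃ c : MonomialIndex d s → ℝ, b ∈ Set.Icc (0 : Fin d → ℝ) 1 →
      (∀ q, |c q| ≤ B + 1) ∧ ∃ n : ℕ → ℕ, StrictMono n ∧
        Filter.Tendsto (fun i => cs (n i) b) Filter.atTop (𝓝 c) := by
    intro b
    by_cases hb : b ∈ Set.Icc (0 : Fin d → ℝ) 1
    · have hcomp : IsCompact (Set.pi Set.univ
          fun _ : MonomialIndex d s => Set.Icc (-((B : ℝ) + 1)) (B + 1)) :=
        isCompact_univ_pi fun _ => isCompact_Icc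
      obtain ⟨c, hc, n, hn, hcn⟩ := hcomp.tendsto_subseq (x := fun i => cs i b)
        fun i q _ => abs_le.mp (hcsb i b hb q)
      exact ⟨c, fun _ => ⟨fun q => abs_le.mpr (hc q (Set.mem_univ q)), n, hn, hcn⟩⟩
    · exact ⟨0, fun h => absurd h hb⟩
  choose c hc using hlim
  refine ⟨c, fun b hb => (hc b hb).1, ?_⟩
  have hmem : ∀ᵐ x ∂(cubeMeasure d), x ∈ (openCube d : Set (Fin d → ℝ)) :=
    ae_restrict_mem measurableSet_openCube
  filter_upwards [ae_tendsto_mollify hf.1, hmem] with x hx hxm b hb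
  obtain ⟨-, n, hn, hcn⟩ := hc b hb
  have hnt := hn.tendsto_atTop
  have hη_lim : Filter.Tendsto (fun i => η (n i)) Filter.atTop (𝓝 0) :=
    tendsto_mollifier_rOut.comp hnt
  have hT_lim : Filter.Tendsto (fun i => T (n i) b) Filter.atTop (𝓝 b) := by
    rw [tendsto_pi_nhds]
    intro l
    have : Filter.Tendsto (fun i => 2 * η (n i) + (1 - 4 * η (n i)) * b l) Filter.atTop
        (𝓝 (2 * 0 + (1 - 4 * 0) * b l)) :=
      (hη_lim.const_mul 2).add ((tendsto_const_nhds.sub (hη_lim.const_mul 4)).mul_const _)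
    simpa using this
  have hxin : ∀ᶠ i in Filter.atTop, ∀ l, x l ∈ Set.Icc (2 * η (n i)) (1 - 2 * η (n i)) := by
    rw [Filter.eventually_all]
    intro l
    obtain ⟨h0, h1⟩ : x l ∈ Set.Ioo (0 : ℝ) 1 := hxm l (Set.mem_univ l)
    filter_upwards [hη_lim.eventually (gt_mem_nhds (show (0 : ℝ) < x l / 2 by linarith)),
      hη_lim.eventually (gt_mem_nhds (show (0 : ℝ) < (1 - x l) / 2 by linarith))] with i h2 h3
    constructor <;> linarith
  have hbound : ∀ᶠ i in Filter.atTop,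
      |F (n i) x - ∑ q, cs (n i) b q * ∏ l, (x (q.2 l) - T (n i) b (q.2 l))| ≤
        (B + 1) * d ^ s * ‖x - T (n i) b‖ ^ s := by
    filter_upwards [hxin] with i hi
    have h := abs_sub_taylor_le hs (hFs (n i)) (T (n i) b) (x - T (n i) b) (M := B + 1) (by
      intro t ht j
      refine hFb (n i) _ (fun l => ?_) s le_rfl j
      have := (convex_Icc (2 * η (n i)) (1 - 2 * η (n i))).add_smul_sub_mem
        (hTm (n i) b hb l) (hi l) ht
      simpa using this)
    rw [add_sub_cancel] at h
    refine le_of_eq_of_le ?_ h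
    congr 2
    rw [Fintype.sum_sigma, ← Fin.sum_univ_eq_sum_range (fun k => ∑ j : Fin k → Fin d,
      ((k.factorial : ℝ)⁻¹ * partialDeriv j (F (n i)) (T (n i) b)) *
        ∏ l, (x - T (n i) b) (j l))]
    rfl
  have hleft : Filter.Tendsto
      (fun i => |F (n i) x - ∑ q, cs (n i) b q * ∏ l, (x (q.2 l) - T (n i) b (q.2 l))|)
      Filter.atTop (𝓝 |f x - ∑ q, c b q * ∏ l, (x (q.2 l) - b (q.2 l))|) := by
    refine ((hx.comp hnt).sub (tendsto_finsetSum _ fun q _ => ?_)).abs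
    refine ((tendsto_pi_nhds.mp hcn) q).mul (tendsto_finsetProd _ fun l _ => ?_)
    exact tendsto_const_nhds.sub ((tendsto_pi_nhds.mp hT_lim) _)
  have hright : Filter.Tendsto (fun i => ((B : ℝ) + 1) * d ^ s * ‖x - T (n i) b‖ ^ s)
      Filter.atTop (𝓝 ((B + 1) * d ^ s * ‖x - b‖ ^ s)) :=
    ((tendsto_const_nhds.sub hT_lim).norm.pow s).const_mul _
  exact le_of_tendsto_of_tendsto hleft hright hbound

end LocalPolynomials

/-! ### Approximate products by iterated sawtooth functions -/

section ApproximateProducts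

theorem relu_nonneg (t : ℝ) : 0 ≤ relu t := le_max_right _ _

theorem relu_of_nonneg {t : ℝ} (ht : 0 ≤ t) : relu t = t := max_eq_left ht

theorem relu_of_nonpos {t : ℝ} (ht : t ≤ 0) : relu t = 0 := max_eq_right ht

/-- The sawtooth `x ↦ min (2 x) (2 - 2 x)` on `[0,1]`, written with rectified linear units. -/
def sawtooth (x : ℝ) : ℝ := relu (2 * x - 4 * relu (x - 1 / 2))

theorem sawtooth_mem (x : ℝ) : sawtooth x ∈ Set.Icc (0 : ℝ) 1 := by
  refine ⟨relu_nonneg _, max_le ?_ zero_le_one⟩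
  rcases le_total x (1 / 2) with h | h
  · rw [relu_of_nonpos (by linarith)]; linarith
  · rw [relu_of_nonneg (by linarith)]; linarith

/-- The self-similarity of the parabola which drives the approximation of squares. -/
theorem sq_eq_sawtooth {x : ℝ} (hx : x ∈ Set.Icc (0 : ℝ) 1) :
    x ^ 2 = x - sawtooth x / 2 + sawtooth x ^ 2 / 4 := by
  obtain ⟨h0, h1⟩ := hx
  unfold sawtooth
  rcases le_total x (1 / 2) with h | h
  · rw [relu_of_nonpos (t := x - 1 / 2) (by linarith), relu_of_nonneg (by linarith)]; ring
  · rw [relu_of_nonneg (t := x - 1 / 2) (by linarith), relu_of_nonneg (by linarith)]; ring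

/-- The piecewise linear interpolation of `x ↦ x ^ 2` on `[0,1]` at the multiples of `2⁻ᵐ`. -/
def sqApprox (m : ℕ) (x : ℝ) : ℝ :=
  x - ∑ k ∈ Finset.range m, sawtooth^[k + 1] x / 4 ^ (k + 1)

theorem sqApprox_succ (m : ℕ) (x : ℝ) :
    sqApprox (m + 1) x = sqApprox m x - sawtooth^[m + 1] x / 4 ^ (m + 1) := by
  rw [sqApprox, Finset.sum_range_succ, sqApprox]; ring

theorem sqApprox_succ' (m : ℕ) (x : ℝ) :
    sqApprox (m + 1) x = x - sawtooth x / 2 + sqApprox m (sawtooth x) / 4 := by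
  rw [sqApprox, Finset.sum_range_succ', sqApprox, sub_div, Finset.sum_div]
  have h : ∀ k ∈ Finset.range m, sawtooth^[k + 1 + 1] x / 4 ^ (k + 1 + 1) =
      sawtooth^[k + 1] (sawtooth x) / 4 ^ (k + 1) / 4 := by
    intro k _
    rw [Function.iterate_succ_apply, pow_succ (4 : ℝ) (k + 1), div_div]
  rw [Finset.sum_congr rfl h]
  simp
  ring

theorem sqApprox_sub_sq_mem (m : ℕ) {x : ℝ} (hx : x ∈ Set.Icc (0 : ℝ) 1) :
    sqApprox m x - x ^ 2 ∈ Set.Icc (0 : ℝ) (1 / 4 ^ (m + 1)) := by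
  induction m generalizing x with
  | zero =>
    obtain ⟨h0, h1⟩ := hx
    simp only [sqApprox, Finset.range_zero, Finset.sum_empty, sub_zero]
    constructor
    · nlinarith
    · nlinarith [sq_nonneg (x - 1 / 2)]
  | succ m ih =>
    obtain ⟨h0, h1⟩ := ih (sawtooth_mem x)
    have h2 : sqApprox (m + 1) x - x ^ 2 =
        (sqApprox m (sawtooth x) - sawtooth x ^ 2) / 4 := by
      rw [sqApprox_succ', sq_eq_sawtooth hx]; ring
    rw [h2]
    refine ⟨by positivity, ?_⟩
    rw [pow_succ (4 : ℝ) (m + 1), ← div_div]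
    linarith

theorem sqApprox_nonneg (m : ℕ) {x : ℝ} (hx : x ∈ Set.Icc (0 : ℝ) 1) : 0 ≤ sqApprox m x := by
  have := (sqApprox_sub_sq_mem m hx).1
  nlinarith [sq_nonneg x]

/-- The polarisation `2 ((a + b) / 2)² - a² / 2 - b² / 2` of the product `a b` with approximate
squares, clipped to `[0,1]`. -/
def mulApprox (m : ℕ) (a b : ℝ) : ℝ :=
  relu (1 - relu (1 - 2 * sqApprox m ((a + b) / 2) + sqApprox m a / 2 + sqApprox m b / 2))

theorem mulApprox_mem (m : ℕ) (a b : ℝ) : mulApprox m a b ∈ Set.Icc (0 : ℝ) 1 := by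
  refine ⟨relu_nonneg _, max_le ?_ zero_le_one⟩
  linarith [relu_nonneg (1 - 2 * sqApprox m ((a + b) / 2) + sqApprox m a / 2 + sqApprox m b / 2)]

theorem abs_mulApprox_sub_le (m : ℕ) {a b : ℝ} (ha : a ∈ Set.Icc (0 : ℝ) 1)
    (hb : b ∈ Set.Icc (0 : ℝ) 1) : |mulApprox m a b - a * b| ≤ 1 / 4 ^ m := by
  have hab : (a + b) / 2 ∈ Set.Icc (0 : ℝ) 1 :=
    ⟨by linarith [ha.1, hb.1], by linarith [ha.2, hb.2]⟩
  obtain ⟨h1, h2⟩ := sqApprox_sub_sq_mem m hab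
  obtain ⟨h3, h4⟩ := sqApprox_sub_sq_mem m ha
  obtain ⟨h5, h6⟩ := sqApprox_sub_sq_mem m hb
  have h7 : (1 : ℝ) / 4 ^ m = 4 * (1 / 4 ^ (m + 1)) := by rw [pow_succ]; field_simp
  have h8 : (0 : ℝ) < 1 / 4 ^ (m + 1) := by positivity
  have h9 : 0 ≤ a * b := mul_nonneg ha.1 hb.1
  have h10 : a * b ≤ 1 := mul_le_one₀ ha.2 hb.1 hb.2
  have h11 : ((a + b) / 2) ^ 2 * 2 - a ^ 2 / 2 - b ^ 2 / 2 = a * b := by ring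
  unfold mulApprox relu
  rw [abs_le]
  constructor
  · have : 1 - max (1 - 2 * sqApprox m ((a + b) / 2) + sqApprox m a / 2 + sqApprox m b / 2) 0
        ≥ a * b - 1 / 4 ^ m := by
      have : max (1 - 2 * sqApprox m ((a + b) / 2) + sqApprox m a / 2 + sqApprox m b / 2) 0 ≤
          1 - a * b + 1 / 4 ^ m := max_le (by linarith) (by linarith)
      linarith
    linarith [le_max_left (1 - max (1 - 2 * sqApprox m ((a + b) / 2) + sqApprox m a / 2 +
      sqApprox m b / 2) 0) (0 : ℝ)]
  · have := le_max_left (1 - 2 * sqApprox m ((a + b) / 2) + sqApprox m a / 2 +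
      sqApprox m b / 2) (0 : ℝ)
    have h12 : max (1 - max (1 - 2 * sqApprox m ((a + b) / 2) + sqApprox m a / 2 +
        sqApprox m b / 2) 0) 0 ≤ a * b + 1 / 4 ^ m := max_le (by linarith) (by linarith)
    linarith

/-- The iterated approximate product of a list of numbers in `[0,1]`. -/
def prodApprox (m : ℕ) (l : List ℝ) : ℝ := l.foldl (mulApprox m) 1

theorem list_prod_mem_Icc (l : List ℝ) (hl : ∀ a ∈ l, a ∈ Set.Icc (0 : ℝ) 1) :
    l.prod ∈ Set.Icc (0 : ℝ) 1 := by
  induction l with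
  | nil => simp
  | cons a l ih =>
    have ha := hl a (by simp)
    have h := ih fun b hb => hl b (by simp [hb])
    rw [List.prod_cons]
    exact ⟨mul_nonneg ha.1 h.1, mul_le_one₀ ha.2 h.1 h.2⟩

theorem abs_foldl_mulApprox_sub_le (m : ℕ) (l : List ℝ) (hl : ∀ a ∈ l, a ∈ Set.Icc (0 : ℝ) 1)
    {p : ℝ} (hp : p ∈ Set.Icc (0 : ℝ) 1) :
    |l.foldl (mulApprox m) p - p * l.prod| ≤ l.length * (1 / 4 ^ m) := by
  induction l generalizing p with
  | nil => simp
  | cons a l ih =>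
    have ha := hl a (by simp)
    have hl' : ∀ b ∈ l, b ∈ Set.Icc (0 : ℝ) 1 := fun b hb => hl b (by simp [hb])
    have h1 := ih hl' (mulApprox_mem m p a)
    have h2 := abs_mulApprox_sub_le m hp ha
    have h3 : l.prod ∈ Set.Icc (0 : ℝ) 1 :=
      list_prod_mem_Icc l hl'
    rw [List.foldl_cons, List.prod_cons, List.length_cons]
    have h4 : l.foldl (mulApprox m) (mulApprox m p a) - p * (a * l.prod) =
        (l.foldl (mulApprox m) (mulApprox m p a) - mulApprox m p a * l.prod) +
          (mulApprox m p a - p * a) * l.prod := by ring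
    have h5 : |(mulApprox m p a - p * a) * l.prod| ≤ 1 / 4 ^ m := by
      rw [abs_mul, abs_of_nonneg h3.1]
      calc _ ≤ 1 / 4 ^ m * 1 := mul_le_mul h2 h3.2 h3.1 (by positivity)
        _ = _ := mul_one _
    rw [h4]
    refine (abs_add_le _ _).trans ?_
    push_cast
    linarith

theorem abs_prodApprox_sub_le (m : ℕ) (l : List ℝ) (hl : ∀ a ∈ l, a ∈ Set.Icc (0 : ℝ) 1) :
    |prodApprox m l - l.prod| ≤ l.length * (1 / 4 ^ m) := by
  simpa [prodApprox] using abs_foldl_mulApprox_sub_le m l hl (p := 1) (by simp)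

end ApproximateProducts

/-! ### Register programs -/

section Programs

variable {ι : Type*} [Fintype ι] [DecidableEq ι]

/-- The instruction `z_target ← relu (⟨coeff, z⟩ + bias)` of a register machine whose registers
are indexed by `ι`. -/
structure Instr (ι : Type*) where
  target : ι
  coeff : ι → ℝ
  bias : ℝ

/-- The effect of an instruction on the registers. -/
def Instr.exec (I : Instr ι) (z : ι → ℝ) : ι → ℝ :=
  Function.update z I.target (relu (I.coeff ⬝ᵥ z + I.bias))

/-- The effect of a list of instructions, the head of the list being executed first. -/
def run (P : List (Instr ι)) (z : ι → ℝ) : ι → ℝ := P.foldl (fun z I => I.exec z) z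

@[simp]
theorem run_nil (z : ι → ℝ) : run [] z = z := rfl

@[simp]
theorem run_cons (I : Instr ι) (P : List (Instr ι)) (z : ι → ℝ) :
    run (I :: P) z = run P (I.exec z) := rfl

@[simp]
theorem run_append (P Q : List (Instr ι)) (z : ι → ℝ) : run (P ++ Q) z = run Q (run P z) :=
  List.foldl_append

theorem Instr.exec_nonneg (I : Instr ι) {z : ι → ℝ} (hz : 0 ≤ z) : 0 ≤ I.exec z := by
  intro i
  by_cases h : i = I.target
  · subst h; simpa [Instr.exec] using relu_nonneg _
  · simpa [Instr.exec, h] using hz i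

theorem run_nonneg (P : List (Instr ι)) {z : ι → ℝ} (hz : 0 ≤ z) : 0 ≤ run P z := by
  induction P generalizing z with
  | nil => exact hz
  | cons I P ih => exact ih (I.exec_nonneg hz)

end Programs

/-! ### Rank-one layers execute instructions -/

section Layers

/-- The layer with weight matrix `α I + u vᵀ`, as a layer of any rank `r ≥ 1`. -/
def rankOneLayer {N : ℕ} (r : ℕ) (α : ℝ) (u v b : Fin N → ℝ) : Layer N r where
  α := α
  U := fun i k => if (k : ℕ) = 0 then u i else 0
  V := fun i k => if (k : ℕ) = 0 then v i else 0
  b := b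

theorem rankOneLayer_affine {N r : ℕ} (hr : 1 ≤ r) (α : ℝ) (u v b z : Fin N → ℝ) (i : Fin N) :
    (rankOneLayer r α u v b).affine z i = α * z i + u i * (v ⬝ᵥ z) + b i := by
  obtain ⟨r, rfl⟩ : ∃ k, r = k + 1 := ⟨r - 1, by omega⟩
  have h : (rankOneLayer (r + 1) α u v b).weight.mulVec z i = α * z i + u i * (v ⬝ᵥ z) := by
    have hUV : ∀ j, ((rankOneLayer (r + 1) α u v b).U *
        (rankOneLayer (r + 1) α u v b).V.transpose) i j = u i * v j := by
      intro j
      have hV : ∀ k, (rankOneLayer (r + 1) α u v b).V j k =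
          if (k : ℕ) = 0 then v j else 0 := fun _ => rfl
      have hU : ∀ k, (rankOneLayer (r + 1) α u v b).U i k =
          if (k : ℕ) = 0 then u i else 0 := fun _ => rfl
      rw [Matrix.mul_apply]
      simp [hU, hV]
    have hα : (rankOneLayer (r + 1) α u v b).α = α := rfl
    rw [Layer.weight, Matrix.add_mulVec, Matrix.smul_mulVec, Matrix.one_mulVec]
    simp [hUV, hα, Matrix.mulVec, dotProduct, Finset.mul_sum, mul_assoc]
  rw [Layer.affine, Pi.add_apply, h]
  rfl

variable {ι : Type*} [Fintype ι] [DecidableEq ι]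

/-- The layer with weight matrix `I + e (coeff - e)ᵀ`, where `e` is the basis vector of the target
register. It replaces the target by the value of the instruction and keeps all other registers. -/
def Instr.toLayer {N : ℕ} (r : ℕ) (e : ι ≃ Fin N) (I : Instr ι) : Layer N r :=
  rankOneLayer r 1 (Pi.single (e I.target) 1)
    (I.coeff ∘ e.symm - Pi.single (e I.target) 1) (Pi.single (e I.target) I.bias)

/-- On non-negative states the rectifier does not change the registers that are kept. -/
theorem Instr.relu_toLayer_affine {N r : ℕ} (hr : 1 ≤ r) (e : ι ≃ Fin N) (I : Instr ι)
    {z : ι → ℝ} (hz : 0 ≤ z) :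
    (fun i => relu ((I.toLayer r e).affine (z ∘ e.symm) i)) = I.exec z ∘ e.symm := by
  ext i
  obtain ⟨i, rfl⟩ := e.surjective i
  rw [Instr.toLayer, rankOneLayer_affine hr, sub_dotProduct, comp_equiv_symm_dotProduct]
  simp only [single_dotProduct, Function.comp_apply, Equiv.symm_apply_apply, Instr.exec]
  by_cases h : i = I.target
  · subst h
    simp only [Pi.single_eq_same, Function.update_self]
    congr 1
    have : (z ∘ e.symm) ∘ e = z := by ext; simp
    rw [this]
    ring
  · have h' : e i ≠ e I.target := fun hh => h (e.injective hh)
    simp [Pi.single_eq_of_ne h', Function.update_of_ne h, relu_of_nonneg (hz i)]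

/-- The hidden layers of a network run a program. -/
theorem foldl_toLayer {N r : ℕ} (hr : 1 ≤ r) (e : ι ≃ Fin N) (P : List (Instr ι)) {z : ι → ℝ}
    (hz : 0 ≤ z) :
    (P.map (Instr.toLayer r e)).foldl (fun z l => fun i => relu (l.affine z i)) (z ∘ e.symm) =
      run P z ∘ e.symm := by
  induction P generalizing z with
  | nil => rfl
  | cons I P ih =>
    rw [List.map_cons, List.foldl_cons, I.relu_toLayer_affine hr e hz, ih (I.exec_nonneg hz),
      run_cons]

theorem Network.paramCount_eq {d r : ℕ} (net : Network d r) :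
    net.paramCount = (net.hidden.length + 1) * (1 + 2 * net.width * r + net.width) := by
  have h : (net.hidden.map Layer.paramCount).sum =
      net.hidden.length * (1 + net.width * r + net.width * r + net.width) := by
    rw [List.sum_eq_card_nsmul _ (1 + net.width * r + net.width * r + net.width)]
    · simp
    · intro n hn
      obtain ⟨l, _, rfl⟩ := List.mem_map.mp hn
      rfl
  rw [Network.paramCount, h]
  simp only [Layer.paramCount]
  ring

end Layers

/-! ### Programs for sums of products -/

section SumsOfProducts

/-- The working registers of the programs below. The register `pos` accumulates the terms with
positive coefficients and `neg` the terms with negative coefficients, so that all registers stay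
non-negative. -/
inductive WorkReg
  | tooth | aux | square | first | second | prod | factor | pos | neg
  deriving DecidableEq

instance : Fintype WorkReg where
  elems := {.tooth, .aux, .square, .first, .second, .prod, .factor, .pos, .neg}
  complete w := by cases w <;> simp

/-- The registers: the input, the working registers, and `r` idle registers, which make the width
exceed `r`. -/
abbrev Reg (d r : ℕ) : Type := Fin d ⊕ WorkReg ⊕ Fin r

variable {d r : ℕ}

/-- A working register among all registers. -/
abbrev work (w : WorkReg) : Reg d r := Sum.inr (Sum.inl w)

open WorkReg

/-- Replaces `square` by the approximate square of `tooth`. -/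
def sqProgram : ℕ → List (Instr (Reg d r))
  | 0 => [⟨work square, Pi.single (work tooth) 1, 0⟩]
  | m + 1 => sqProgram m ++
    [⟨work aux, Pi.single (work tooth) 1, -(1 / 2)⟩,
      ⟨work tooth, Pi.single (work tooth) 2 - Pi.single (work aux) 4, 0⟩,
      ⟨work square, Pi.single (work square) 1 - Pi.single (work tooth) (1 / 4 ^ (m + 1)), 0⟩]

theorem length_sqProgram (m : ℕ) : (sqProgram m : List (Instr (Reg d r))).length = 3 * m + 1 := by
  induction m with
  | zero => rfl
  | succ m ih => rw [sqProgram, List.length_append, ih]; simp; ring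

theorem run_sqProgram (m : ℕ) {z : Reg d r → ℝ}
    (ht : z (work tooth) ∈ Set.Icc (0 : ℝ) 1) :
    run (sqProgram m) z (work tooth) = sawtooth^[m] (z (work tooth)) ∧
      run (sqProgram m) z (work square) = sqApprox m (z (work tooth)) ∧
      ∀ i, i ≠ work tooth → i ≠ work aux → i ≠ work square → run (sqProgram m) z i = z i := by
  induction m with
  | zero =>
    refine ⟨?_, ?_, fun i h1 h2 h3 => ?_⟩
    · simp [sqProgram, Instr.exec]
    · simp [sqProgram, Instr.exec, sqApprox, relu_of_nonneg ht.1]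
    · simp [sqProgram, Instr.exec, h3]
  | succ m ih =>
    obtain ⟨h1, h2, h3⟩ := ih
    have hnn := sqApprox_nonneg (m + 1) ht
    rw [sqApprox_succ, Function.iterate_succ_apply'] at hnn
    have hs : relu (2 * sawtooth^[m] (z (work tooth)) -
        4 * relu (sawtooth^[m] (z (work tooth)) + -(1 / 2))) =
          sawtooth (sawtooth^[m] (z (work tooth))) := by
      rw [sawtooth, sub_eq_add_neg _ (1 / 2 : ℝ)]
    set w := run (sqProgram m) z with hw
    have h4 : run (sqProgram (m + 1)) z (work tooth) =
        sawtooth (sawtooth^[m] (z (work tooth))) := by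
      rw [sqProgram, run_append, ← hw, ← hs, ← h1]
      simp [Instr.exec, sub_dotProduct]
    refine ⟨?_, ?_, fun i h5 h6 h7 => ?_⟩
    · rw [h4, Function.iterate_succ_apply']
    · rw [sqApprox_succ, Function.iterate_succ_apply', ← relu_of_nonneg hnn, ← h2, ← hs, ← h1,
        sqProgram, run_append, ← hw]
      simp [Instr.exec, sub_dotProduct]
      ring_nf
    · rw [sqProgram, run_append, ← hw, ← h3 i h5 h6 h7]
      simp [Instr.exec, h5, h6, h7]

/-- Two states have the same inputs and the same accumulated sums. -/
def SameSums (z w : Reg d r → ℝ) : Prop :=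
  (∀ j, z (Sum.inl j) = w (Sum.inl j)) ∧ z (work pos) = w (work pos) ∧ z (work neg) = w (work neg)

theorem SameSums.trans {z w y : Reg d r → ℝ} (h : SameSums z w) (h' : SameSums w y) :
    SameSums z y :=
  ⟨fun j => (h.1 j).trans (h'.1 j), h.2.1.trans h'.2.1, h.2.2.trans h'.2.2⟩

/-- Replaces `prod` by its approximate product with `factor`. -/
def mulProgram (m : ℕ) : List (Instr (Reg d r)) :=
  [⟨work tooth, Pi.single (work prod) (1 / 2) + Pi.single (work factor) (1 / 2), 0⟩] ++
    sqProgram m ++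
    [⟨work first, Pi.single (work square) 1, 0⟩, ⟨work tooth, Pi.single (work prod) 1, 0⟩] ++
    sqProgram m ++
    [⟨work second, Pi.single (work square) 1, 0⟩, ⟨work tooth, Pi.single (work factor) 1, 0⟩] ++
    sqProgram m ++
    [⟨work aux, Pi.single (work first) (-2) + Pi.single (work second) (1 / 2) +
        Pi.single (work square) (1 / 2), 1⟩,
      ⟨work prod, -Pi.single (work aux) 1, 1⟩]

theorem length_mulProgram (m : ℕ) :
    (mulProgram m : List (Instr (Reg d r))).length = 9 * m + 10 := by
  simp [mulProgram, length_sqProgram]; ring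

theorem run_mulProgram (m : ℕ) {z : Reg d r → ℝ}
    (hp : z (work prod) ∈ Set.Icc (0 : ℝ) 1) (ha : z (work factor) ∈ Set.Icc (0 : ℝ) 1) :
    run (mulProgram m) z (work prod) = mulApprox m (z (work prod)) (z (work factor)) ∧
      SameSums (run (mulProgram m) z) z := by
  have hpa : (z (work prod) + z (work factor)) / 2 ∈ Set.Icc (0 : ℝ) 1 :=
    ⟨by linarith [hp.1, ha.1], by linarith [hp.2, ha.2]⟩
  set z₁ : Reg d r → ℝ := Instr.exec
    ⟨work tooth, Pi.single (work prod) (1 / 2) + Pi.single (work factor) (1 / 2), 0⟩ z with hz₁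
  have t₁ : z₁ (work tooth) = (z (work prod) + z (work factor)) / 2 := by
    rw [← relu_of_nonneg hpa.1]
    simp [hz₁, Instr.exec, add_dotProduct]
    ring_nf
  have o₁ : ∀ i, i ≠ work tooth → z₁ i = z i := fun i hi => by simp [hz₁, Instr.exec, hi]
  obtain ⟨-, s₁, k₁⟩ := run_sqProgram m (z := z₁) (by rw [t₁]; exact hpa)
  set z₂ := run (sqProgram m) z₁ with hz₂
  have n₂ : 0 ≤ z₂ (work square) := by rw [s₁]; exact sqApprox_nonneg m (by rw [t₁]; exact hpa)
  set z₃ : Reg d r → ℝ := run [⟨work first, Pi.single (work square) 1, 0⟩,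
    ⟨work tooth, Pi.single (work prod) 1, 0⟩] z₂ with hz₃
  have p₂ : z₂ (work prod) = z (work prod) := by
    rw [k₁ _ (by simp) (by simp) (by simp), o₁ _ (by simp)]
  have t₃ : z₃ (work tooth) = z (work prod) := by
    simp [hz₃, Instr.exec, p₂, relu_of_nonneg hp.1]
  have f₃ : z₃ (work first) = sqApprox m ((z (work prod) + z (work factor)) / 2) := by
    rw [← t₁, ← s₁]
    simp [hz₃, Instr.exec, relu_of_nonneg n₂]
  have o₃ : ∀ i, i ≠ work tooth → i ≠ work first → z₃ i = z₂ i := fun i h1 h2 => by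
    simp [hz₃, Instr.exec, h1, h2]
  obtain ⟨-, s₃, k₃⟩ := run_sqProgram m (z := z₃) (by rw [t₃]; exact hp)
  set z₄ := run (sqProgram m) z₃ with hz₄
  have n₄ : 0 ≤ z₄ (work square) := by rw [s₃]; exact sqApprox_nonneg m (by rw [t₃]; exact hp)
  set z₅ : Reg d r → ℝ := run [⟨work second, Pi.single (work square) 1, 0⟩,
    ⟨work tooth, Pi.single (work factor) 1, 0⟩] z₄ with hz₅
  have a₄ : z₄ (work factor) = z (work factor) := by
    rw [k₃ _ (by simp) (by simp) (by simp), o₃ _ (by simp) (by simp),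
      k₁ _ (by simp) (by simp) (by simp), o₁ _ (by simp)]
  have f₄ : z₄ (work first) = z₃ (work first) := k₃ _ (by simp) (by simp) (by simp)
  have t₅ : z₅ (work tooth) = z (work factor) := by
    simp [hz₅, Instr.exec, a₄, relu_of_nonneg ha.1]
  have g₅ : z₅ (work second) = sqApprox m (z (work prod)) := by
    rw [← t₃, ← s₃]
    simp [hz₅, Instr.exec, relu_of_nonneg n₄]
  have o₅ : ∀ i, i ≠ work tooth → i ≠ work second → z₅ i = z₄ i := fun i h1 h2 => by
    simp [hz₅, Instr.exec, h1, h2]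
  obtain ⟨-, s₅, k₅⟩ := run_sqProgram m (z := z₅) (by rw [t₅]; exact ha)
  set z₆ := run (sqProgram m) z₅ with hz₆
  have g₆ : z₆ (work second) = z₅ (work second) := k₅ _ (by simp) (by simp) (by simp)
  have f₆ : z₆ (work first) = z₃ (work first) := by
    rw [k₅ _ (by simp) (by simp) (by simp), o₅ _ (by simp) (by simp), f₄]
  have hrun : run (mulProgram m) z = run [⟨work aux, Pi.single (work first) (-2) +
      Pi.single (work second) (1 / 2) + Pi.single (work square) (1 / 2), 1⟩,
      ⟨work prod, -Pi.single (work aux) 1, 1⟩] z₆ := by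
    rw [hz₆, hz₅, hz₄, hz₃, hz₂, hz₁]
    simp only [mulProgram, run_append, run_cons, run_nil]
  have o₇ : ∀ i, i ≠ work aux → i ≠ work prod → i ≠ work tooth → i ≠ work first →
      i ≠ work second → i ≠ work square → run (mulProgram m) z i = z i := by
    intro i h1 h2 h3 h4 h5 h6
    rw [hrun, ← o₁ i h3, ← k₁ i h3 h1 h6, ← o₃ i h3 h4, ← k₃ i h3 h1 h6, ← o₅ i h3 h5,
      ← k₅ i h3 h1 h6]
    simp [Instr.exec, h1, h2]
  refine ⟨?_, fun j => ?_, ?_, ?_⟩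
  · rw [hrun, mulApprox, ← f₃, ← g₅, ← t₅, ← s₅, ← g₆, ← f₆]
    simp [Instr.exec, add_dotProduct]
    ring_nf
  all_goals exact o₇ _ (by simp) (by simp) (by simp) (by simp) (by simp) (by simp)

/-- A factor `x ↦ relu (1 - relu (a x_j + b) - relu (a' x_j + b'))` of a product. This family
contains hat functions and truncated monomials of degree one. -/
structure Factor (d : ℕ) where
  coord : Fin d
  slope₁ : ℝ
  offset₁ : ℝ
  slope₂ : ℝ
  offset₂ : ℝ

/-- The value of a factor. -/
def Factor.eval (φ : Factor d) (x : Fin d → ℝ) : ℝ :=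
  relu (1 - relu (φ.slope₁ * x φ.coord + φ.offset₁) - relu (φ.slope₂ * x φ.coord + φ.offset₂))

theorem Factor.eval_mem (φ : Factor d) (x : Fin d → ℝ) : φ.eval x ∈ Set.Icc (0 : ℝ) 1 := by
  refine ⟨relu_nonneg _, max_le ?_ zero_le_one⟩
  linarith [relu_nonneg (φ.slope₁ * x φ.coord + φ.offset₁),
    relu_nonneg (φ.slope₂ * x φ.coord + φ.offset₂)]

/-- Stores the value of a factor in `factor`. -/
def Factor.program (φ : Factor d) : List (Instr (Reg d r)) :=
  [⟨work aux, Pi.single (Sum.inl φ.coord) φ.slope₁, φ.offset₁⟩,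
    ⟨work tooth, Pi.single (Sum.inl φ.coord) φ.slope₂, φ.offset₂⟩,
    ⟨work factor, -Pi.single (work aux) 1 - Pi.single (work tooth) 1, 1⟩]

theorem Factor.run_program (φ : Factor d) (z : Reg d r → ℝ) :
    run φ.program z (work factor) = φ.eval (z ∘ Sum.inl) ∧
      run φ.program z (work prod) = z (work prod) ∧ SameSums (run φ.program z) z := by
  refine ⟨?_, ?_, fun j => ?_, ?_, ?_⟩
  · simp [Factor.program, Instr.exec, Factor.eval, sub_dotProduct]
    ring_nf
  all_goals simp [Factor.program, Instr.exec]

/-- Multiplies `prod` by all factors of a list. -/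
def prodProgram (m : ℕ) (l : List (Factor d)) : List (Instr (Reg d r)) :=
  l.flatMap fun φ => φ.program ++ mulProgram m

theorem length_prodProgram (m : ℕ) (l : List (Factor d)) :
    (prodProgram m l : List (Instr (Reg d r))).length = l.length * (9 * m + 13) := by
  induction l with
  | nil => simp [prodProgram]
  | cons φ l ih =>
    rw [prodProgram, List.flatMap_cons, List.length_append, ← prodProgram, ih]
    simp [Factor.program, length_mulProgram]
    ring

theorem run_prodProgram (m : ℕ) (l : List (Factor d)) {z : Reg d r → ℝ}
    (hp : z (work prod) ∈ Set.Icc (0 : ℝ) 1) :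
    run (prodProgram m l) z (work prod) =
        (l.map fun φ => φ.eval (z ∘ Sum.inl)).foldl (mulApprox m) (z (work prod)) ∧
      SameSums (run (prodProgram m l) z) z := by
  induction l generalizing z with
  | nil => exact ⟨rfl, fun _ => rfl, rfl, rfl⟩
  | cons φ l ih =>
    obtain ⟨h1, h2, h3⟩ := φ.run_program z
    obtain ⟨h4, h5⟩ := run_mulProgram m (z := run φ.program z) (by rw [h2]; exact hp)
      (by rw [h1]; exact φ.eval_mem _)
    rw [h1, h2] at h4
    obtain ⟨h6, h7⟩ := ih (z := run (mulProgram m) (run φ.program z))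
      (by rw [h4]; exact mulApprox_mem _ _ _)
    have h8 : run (mulProgram m) (run φ.program z) ∘ Sum.inl = z ∘ Sum.inl :=
      funext fun j => (h5.trans h3).1 j
    rw [prodProgram, List.flatMap_cons, run_append, run_append, ← prodProgram]
    refine ⟨?_, h7.trans (h5.trans h3)⟩
    rw [h6, h8, h4, List.map_cons, List.foldl_cons]

/-- Adds the approximate value of `c * ∏ φ ∈ l, φ x` to the accumulated sums. -/
def termProgram (m : ℕ) (t : ℝ × List (Factor d)) : List (Instr (Reg d r)) :=
  [⟨work prod, 0, 1⟩] ++ prodProgram m t.2 ++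
    [⟨work pos, Pi.single (work pos) 1 + Pi.single (work prod) (relu t.1), 0⟩,
      ⟨work neg, Pi.single (work neg) 1 + Pi.single (work prod) (relu (-t.1)), 0⟩]

/-- The approximate value of `c * ∏ φ ∈ l, φ x`. -/
def termApprox (m : ℕ) (x : Fin d → ℝ) (t : ℝ × List (Factor d)) : ℝ :=
  t.1 * prodApprox m (t.2.map fun φ => φ.eval x)

theorem run_termProgram (m : ℕ) (t : ℝ × List (Factor d)) {z : Reg d r → ℝ} (hz : 0 ≤ z) :
    run (termProgram m t) z (work pos) - run (termProgram m t) z (work neg) =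
        z (work pos) - z (work neg) + termApprox m (z ∘ Sum.inl) t ∧
      run (termProgram m t) z ∘ Sum.inl = z ∘ Sum.inl := by
  set z₁ : Reg d r → ℝ := Instr.exec ⟨work prod, 0, 1⟩ z with hz₁
  have p₁ : z₁ (work prod) = 1 := by simp [hz₁, Instr.exec, relu]
  have o₁ : SameSums z₁ z := ⟨fun j => by simp [hz₁, Instr.exec], by simp [hz₁, Instr.exec],
    by simp [hz₁, Instr.exec]⟩
  obtain ⟨p₂, o₂⟩ := run_prodProgram m t.2 (z := z₁) (by rw [p₁]; simp)
  set z₂ := run (prodProgram m t.2) z₁ with hz₂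
  have hnn : 0 ≤ z₂ := run_nonneg _ (Instr.exec_nonneg _ hz)
  have hin : z₁ ∘ Sum.inl = z ∘ Sum.inl := funext fun j => o₁.1 j
  obtain ⟨oj, op, on⟩ := o₂.trans o₁
  have hprod : z₂ (work prod) = prodApprox m (t.2.map fun φ => φ.eval (z ∘ Sum.inl)) := by
    rw [p₂, p₁, hin, prodApprox]
  have hrun : run (termProgram m t) z =
      run [⟨work pos, Pi.single (work pos) 1 + Pi.single (work prod) (relu t.1), 0⟩,
        ⟨work neg, Pi.single (work neg) 1 + Pi.single (work prod) (relu (-t.1)), 0⟩] z₂ := by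
    rw [hz₂, hz₁]
    simp only [termProgram, run_append, run_cons, run_nil]
  have hc : t.1 = relu t.1 - relu (-t.1) := by
    rcases le_total 0 t.1 with h | h
    · rw [relu_of_nonneg h, relu_of_nonpos (by linarith)]; ring
    · rw [relu_of_nonpos h, relu_of_nonneg (by linarith)]; ring
  have hpos : run (termProgram m t) z (work pos) =
      z₂ (work pos) + relu t.1 * z₂ (work prod) := by
    have : 0 ≤ z₂ (work pos) + relu t.1 * z₂ (work prod) :=
      add_nonneg (hnn _) (mul_nonneg (relu_nonneg _) (hnn _))
    rw [hrun]
    simp [Instr.exec, add_dotProduct, relu_of_nonneg this]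
  have hneg : run (termProgram m t) z (work neg) =
      z₂ (work neg) + relu (-t.1) * z₂ (work prod) := by
    have : 0 ≤ z₂ (work neg) + relu (-t.1) * z₂ (work prod) :=
      add_nonneg (hnn _) (mul_nonneg (relu_nonneg _) (hnn _))
    rw [hrun]
    simp [Instr.exec, add_dotProduct, relu_of_nonneg this]
  constructor
  · rw [hpos, hneg, op, on, termApprox, ← hprod]
    nth_rewrite 3 [hc]
    ring
  · ext j
    rw [Function.comp_apply, hrun, Function.comp_apply, ← oj j]
    simp [Instr.exec]

/-- Adds the approximate values of all terms of a list to the accumulated sums. -/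
def sumProgram (m : ℕ) (L : List (ℝ × List (Factor d))) : List (Instr (Reg d r)) :=
  L.flatMap (termProgram m)

theorem length_sumProgram_le (m K : ℕ) (L : List (ℝ × List (Factor d)))
    (hL : ∀ t ∈ L, t.2.length ≤ K) :
    (sumProgram m L : List (Instr (Reg d r))).length ≤ L.length * (K * (9 * m + 13) + 3) := by
  induction L with
  | nil => simp [sumProgram]
  | cons t L ih =>
    have h1 := ih fun t ht => hL t (by simp [ht])
    have h2 : t.2.length * (9 * m + 13) ≤ K * (9 * m + 13) :=
      Nat.mul_le_mul_right _ (hL t (by simp))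
    have h3 : (termProgram m t : List (Instr (Reg d r))).length =
        t.2.length * (9 * m + 13) + 3 := by
      simp [termProgram, length_prodProgram]
    rw [sumProgram, List.flatMap_cons, List.length_append, ← sumProgram, h3, List.length_cons,
      add_mul, one_mul]
    omega

theorem run_sumProgram (m : ℕ) (L : List (ℝ × List (Factor d))) {z : Reg d r → ℝ} (hz : 0 ≤ z) :
    run (sumProgram m L) z (work pos) - run (sumProgram m L) z (work neg) =
      z (work pos) - z (work neg) + (L.map (termApprox m (z ∘ Sum.inl))).sum := by
  induction L generalizing z with
  | nil => simp [sumProgram]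
  | cons t L ih =>
    obtain ⟨h1, h2⟩ := run_termProgram m t hz
    rw [sumProgram, List.flatMap_cons, run_append, ← sumProgram, ih (run_nonneg _ hz), h1, h2,
      List.map_cons, List.sum_cons]
    ring

/-- The identification of the registers with the coordinates of `ℝ^N`, `N = d + (9 + r)`. The
first `d` coordinates are the inputs. -/
def regEquiv (d r : ℕ) : Reg d r ≃ Fin (d + (9 + r)) :=
  ((Equiv.refl _).sumCongr
    (((Fintype.equivFinOfCardEq rfl : WorkReg ≃ Fin 9).sumCongr (Equiv.refl _)).trans
      finSumFinEquiv)).trans finSumFinEquiv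

theorem pad_eq_comp_regEquiv (x : Fin d → ℝ) :
    pad (d + (9 + r)) x = Sum.elim x 0 ∘ (regEquiv d r).symm := by
  ext i
  obtain ⟨i, rfl⟩ := (regEquiv d r).surjective i
  rcases i with i | i
  · simp [pad, regEquiv]
  · simp [pad, regEquiv]

/-- A sum of products of factors is computed approximately by a network with diagonal plus
low-rank weights, whose size is proportional to the number of factors. -/
theorem exists_network_of_terms (hr : 1 ≤ r) (m K : ℕ) (L : List (ℝ × List (Factor d)))
    (hL : ∀ t ∈ L, t.2.length ≤ K) :
    ∃ net : Network d r,
      (∀ x ∈ Set.Icc (0 : Fin d → ℝ) 1, net.eval relu x = (L.map (termApprox m x)).sum) ∧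
      net.paramCount ≤ (L.length * (K * (9 * m + 13) + 3) + 1) *
        (1 + 2 * (d + (9 + r)) * r + (d + (9 + r))) := by
  set e := regEquiv d r with he
  refine ⟨{ width := d + (9 + r)
            input_le := by omega
            rank_lt := by omega
            hidden := (sumProgram m L).map (Instr.toLayer r e)
            output := rankOneLayer r 0 1
              ((Pi.single (work pos) 1 - Pi.single (work neg) 1) ∘ e.symm) 0 },
    fun x hx => ?_, ?_⟩
  · have hz : (0 : Reg d r → ℝ) ≤ Sum.elim x 0 := by
      rintro (i | i)
      · exact hx.1 i
      · exact le_rfl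
    have h := run_sumProgram m L hz
    rw [Network.eval, pad_eq_comp_regEquiv, foldl_toLayer hr e _ hz, rankOneLayer_affine hr]
    have h2 : (run (sumProgram m L) (Sum.elim x 0) ∘ e.symm) ∘ e =
        run (sumProgram m L) (Sum.elim x 0) := by ext; simp
    rw [comp_equiv_symm_dotProduct, h2, sub_dotProduct, single_dotProduct, single_dotProduct]
    simpa using h
  · rw [Network.paramCount_eq]
    refine Nat.mul_le_mul_right _ (Nat.succ_le_succ ?_)
    rw [List.length_map]
    exact length_sumProgram_le m K L hL

end SumsOfProducts

/-! ### A piecewise linear partition of unity -/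

section PartitionOfUnity

variable {d : ℕ}

/-- The ramp which rises from `0` to `1` on the unit interval. -/
def ramp (t : ℝ) : ℝ := min (max t 0) 1

/-- A hat is a difference of two ramps, so the sum of consecutive hats telescopes. -/
theorem hat_eq_ramp_sub_ramp (t : ℝ) :
    relu (1 - relu t - relu (-t)) = ramp (t + 1) - ramp t := by
  rcases le_total 0 t with h0 | h0
  · rw [relu_of_nonneg h0, relu_of_nonpos (t := -t) (by linarith), ramp, ramp,
      max_eq_left (a := t + 1) (by linarith), max_eq_left h0, min_eq_right (a := t + 1)
      (by linarith)]
    rcases le_total t 1 with h1 | h1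
    · rw [min_eq_left h1, relu_of_nonneg (by linarith)]; ring
    · rw [min_eq_right h1, relu_of_nonpos (by linarith)]; ring
  · rw [relu_of_nonpos h0, relu_of_nonneg (t := -t) (by linarith), ramp, ramp,
      max_eq_right h0, min_eq_left (a := (0 : ℝ)) zero_le_one]
    rcases le_total (-1) t with h1 | h1
    · rw [max_eq_left (by linarith), min_eq_left (by linarith), relu_of_nonneg (by linarith)]
      ring
    · rw [max_eq_right (by linarith), min_eq_left (by linarith), relu_of_nonpos (by linarith)]
      ring

/-- The hat function `x ↦ max 0 (1 - |n x_i - μ|)`. -/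
def hatFactor (n : ℕ) (i : Fin d) (μ : ℕ) : Factor d := ⟨i, n, -μ, -n, μ⟩

theorem hatFactor_eval (n : ℕ) (i : Fin d) (μ : ℕ) (x : Fin d → ℝ) :
    (hatFactor n i μ).eval x = ramp (n * x i - μ + 1) - ramp (n * x i - μ) := by
  rw [← hat_eq_ramp_sub_ramp, Factor.eval, hatFactor]
  congr 3
  all_goals ring_nf

theorem abs_sub_lt_of_hatFactor_ne_zero {n : ℕ} {i : Fin d} {μ : ℕ} {x : Fin d → ℝ}
    (h : (hatFactor n i μ).eval x ≠ 0) : |n * x i - μ| < 1 := by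
  by_contra! hle
  apply h
  rw [hatFactor_eval, ramp, ramp]
  rcases le_abs.mp hle with h1 | h1
  · rw [max_eq_left (by linarith), max_eq_left (by linarith), min_eq_right (by linarith),
      min_eq_right (by linarith), sub_self]
  · rw [max_eq_right (by linarith), max_eq_right (by linarith), sub_self]

theorem sum_hatFactor {n : ℕ} (i : Fin d) {x : Fin d → ℝ} (hx : x ∈ Set.Icc 0 1) :
    ∑ μ : Fin (n + 1), (hatFactor n i μ).eval x = 1 := by
  have h0 : 0 ≤ x i := hx.1 i
  have h1 : x i ≤ 1 := hx.2 i
  have hn : (0 : ℝ) ≤ n := Nat.cast_nonneg n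
  rw [Fin.sum_univ_eq_sum_range (fun μ => (hatFactor n i μ).eval x)]
  have h : ∀ μ ∈ Finset.range (n + 1), (hatFactor n i μ).eval x =
      ramp (n * x i - (μ : ℕ) + 1) - ramp (n * x i - ((μ + 1 : ℕ) : ℝ) + 1) := by
    intro μ _
    rw [hatFactor_eval]
    push_cast
    ring_nf
  rw [Finset.sum_congr rfl h, Finset.sum_range_sub' (fun μ : ℕ => ramp (n * x i - μ + 1))]
  have h2 : 0 ≤ n * x i := mul_nonneg hn h0
  have h3 : n * x i ≤ n := mul_le_of_le_one_right hn h1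
  push_cast
  rw [ramp, ramp, max_eq_left (by linarith), min_eq_right (by linarith),
    max_eq_right (by linarith), min_eq_left zero_le_one, sub_zero]

theorem sum_prod_hatFactor {n : ℕ} {x : Fin d → ℝ} (hx : x ∈ Set.Icc 0 1) :
    ∑ μ : Fin d → Fin (n + 1), ∏ i, (hatFactor n i (μ i)).eval x = 1 := by
  rw [← Fintype.piFinset_univ,
    Finset.sum_prod_piFinset Finset.univ fun i (μ : Fin (n + 1)) => (hatFactor n i μ).eval x]
  exact Finset.prod_eq_one fun i _ => sum_hatFactor i hx

/-- The truncated linear function `x ↦ max 0 (x_i - b)` on the unit cube, for `b ∈ [0,1]`. -/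
def rampFactor (i : Fin d) (b : ℝ) : Factor d := ⟨i, -1, 1 + b, 0, 0⟩

theorem rampFactor_eval {i : Fin d} {b : ℝ} {x : Fin d → ℝ} (hb : 0 ≤ b) (hbx : b ≤ x i)
    (hx : x i ≤ 1) : (rampFactor i b).eval x = x i - b := by
  rw [Factor.eval, rampFactor, relu_of_nonneg (t := -1 * x i + (1 + b)) (by linarith),
    relu_of_nonpos (t := 0 * x i + 0) (by linarith), relu_of_nonneg (by linarith)]
  ring

/-- The lower corner, within the unit cube, of the support of the hat function with index `μ`. The
truncated subtraction accounts for the hats at the boundary. -/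
def corner (n : ℕ) (μ : Fin d → Fin (n + 1)) : Fin d → ℝ := fun i => ((μ i - 1 : ℕ) : ℝ) / n

theorem corner_mem {n : ℕ} (hn : 1 ≤ n) (μ : Fin d → Fin (n + 1)) :
    corner n μ ∈ Set.Icc (0 : Fin d → ℝ) 1 := by
  have hn' : (0 : ℝ) < n := by exact_mod_cast hn
  refine ⟨fun i => by simp only [corner, Pi.zero_apply]; positivity, fun i => ?_⟩
  rw [corner, Pi.one_apply, div_le_one hn']
  have := (μ i).2
  exact_mod_cast (by omega : (μ i : ℕ) - 1 ≤ n)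

theorem corner_le_of_hatFactor_ne_zero {n : ℕ} (hn : 1 ≤ n) {μ : Fin d → Fin (n + 1)}
    {x : Fin d → ℝ} (hx : x ∈ Set.Icc (0 : Fin d → ℝ) 1) {i : Fin d}
    (h : (hatFactor n i (μ i)).eval x ≠ 0) :
    corner n μ i ≤ x i ∧ x i - corner n μ i ≤ 2 / n := by
  have hn' : (0 : ℝ) < n := by exact_mod_cast hn
  obtain ⟨h1, h2⟩ := abs_lt.mp (abs_sub_lt_of_hatFactor_ne_zero h)
  have h0 : 0 ≤ x i := hx.1 i
  have h3 : ((μ i : ℕ) : ℝ) ≤ ((μ i - 1 : ℕ) : ℝ) + 1 := by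
    exact_mod_cast (by omega : (μ i : ℕ) ≤ (μ i - 1) + 1)
  constructor
  · rw [corner, div_le_iff₀ hn']
    rcases Nat.eq_zero_or_pos (μ i : ℕ) with h4 | h4
    · simp only [h4, zero_tsub, Nat.cast_zero]; positivity
    · rw [Nat.cast_sub h4, Nat.cast_one]; linarith
  · rw [corner, sub_le_iff_le_add, ← add_div, le_div_iff₀ hn']
    linarith

end PartitionOfUnity

/-! ### Approximation on a grid -/

section GridApproximation

variable {d s : ℕ}

/-- The monomial with index `q`, centred at the corner of the cell `μ`, times the hat function of
this cell. -/
def gridTerm (n : ℕ) (c : (Fin d → ℝ) → MonomialIndex d s → ℝ)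
    (p : (Fin d → Fin (n + 1)) × MonomialIndex d s) : ℝ × List (Factor d) :=
  (c (corner n p.1) p.2, List.ofFn (fun i => hatFactor n i (p.1 i)) ++
    List.ofFn fun l => rampFactor (p.2.2 l) (corner n p.1 (p.2.2 l)))

theorem length_gridTerm_le (n : ℕ) (c : (Fin d → ℝ) → MonomialIndex d s → ℝ)
    (p : (Fin d → Fin (n + 1)) × MonomialIndex d s) : (gridTerm n c p).2.length ≤ d + s := by
  have := p.2.1.2
  simp only [gridTerm, List.length_append, List.length_ofFn]
  omega

/-- The average of the local polynomials, weighted by the hat functions, inherits their error: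
only those with corners at distance at most `2 / n` contribute. -/
theorem abs_sub_sum_gridTerm_le {n : ℕ} (hn : 1 ≤ n)
    {c : (Fin d → ℝ) → MonomialIndex d s → ℝ} {x : Fin d → ℝ} (hx : x ∈ Set.Icc (0 : Fin d → ℝ) 1)
    {y A : ℝ} (hA : 0 ≤ A)
    (hc : ∀ b ∈ Set.Icc (0 : Fin d → ℝ) 1,
      |y - ∑ q, c b q * ∏ l, (x (q.2 l) - b (q.2 l))| ≤ A * ‖x - b‖ ^ s) :
    |y - ∑ p, (gridTerm n c p).1 * ((gridTerm n c p).2.map fun φ => φ.eval x).prod| ≤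
      A * (2 / n) ^ s := by
  set w : (Fin d → Fin (n + 1)) → ℝ := fun μ => ∏ i, (hatFactor n i (μ i)).eval x with hw
  set P : (Fin d → Fin (n + 1)) → ℝ := fun μ => ∑ q, c (corner n μ) q *
    ∏ l, (rampFactor (q.2 l) (corner n μ (q.2 l))).eval x with hP
  have hw0 : ∀ μ, 0 ≤ w μ := fun μ => Finset.prod_nonneg fun i _ => (Factor.eval_mem _ _).1
  have hw1 : ∑ μ, w μ = 1 := sum_prod_hatFactor hx
  have hsum : ∑ p, (gridTerm n c p).1 * ((gridTerm n c p).2.map fun φ => φ.eval x).prod =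
      ∑ μ, w μ * P μ := by
    rw [Fintype.sum_prod_type]
    refine Finset.sum_congr rfl fun μ _ => ?_
    rw [hP, Finset.mul_sum]
    refine Finset.sum_congr rfl fun q _ => ?_
    simp only [gridTerm, List.map_append, List.prod_append, List.map_ofFn, List.prod_ofFn,
      Function.comp_apply, hw]
    ring
  have hdiff : y - ∑ μ, w μ * P μ = ∑ μ, w μ * (y - P μ) := by
    simp only [mul_sub, Finset.sum_sub_distrib, ← Finset.sum_mul, hw1, one_mul]
  have hterm : ∀ μ, |w μ * (y - P μ)| ≤ w μ * (A * (2 / n) ^ s) := by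
    intro μ
    rw [abs_mul, abs_of_nonneg (hw0 μ)]
    by_cases h0 : w μ = 0
    · simp [h0]
    · have hne : ∀ i, (hatFactor n i (μ i)).eval x ≠ 0 := fun i hi =>
        h0 (Finset.prod_eq_zero (Finset.mem_univ i) hi)
      have hcor := fun i => corner_le_of_hatFactor_ne_zero hn hx (hne i)
      have hPe : P μ = ∑ q, c (corner n μ) q * ∏ l, (x (q.2 l) - corner n μ (q.2 l)) := by
        refine Finset.sum_congr rfl fun q _ => ?_
        congr 1
        exact Finset.prod_congr rfl fun l _ => rampFactor_eval ((corner_mem hn μ).1 _)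
          (hcor _).1 (hx.2 _)
      have hnorm : ‖x - corner n μ‖ ≤ 2 / n := by
        rw [pi_norm_le_iff_of_nonneg (by positivity)]
        intro i
        rw [Pi.sub_apply, Real.norm_of_nonneg (sub_nonneg.mpr (hcor i).1)]
        exact (hcor i).2
      refine mul_le_mul_of_nonneg_left ?_ (hw0 μ)
      rw [hPe]
      refine (hc _ (corner_mem hn μ)).trans ?_
      gcongr
  rw [hsum, hdiff]
  calc |∑ μ, w μ * (y - P μ)| ≤ ∑ μ, w μ * (A * (2 / n) ^ s) :=
        (Finset.abs_sum_le_sum_abs _ _).trans (Finset.sum_le_sum fun μ _ => hterm μ)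
    _ = A * (2 / n) ^ s := by rw [← Finset.sum_mul, hw1, one_mul]

/-- The first error term is that of the local polynomials, the second one that of the approximate
products. -/
theorem exists_network_of_grid {r : ℕ} (hs : 1 ≤ s) (hr : 1 ≤ r) {f : (Fin d → ℝ) → ℝ} {B : ℝ≥0}
    (hf : MemSobolev s f) (hB : sobolevNorm s f ≤ B) {n : ℕ} (hn : 1 ≤ n) (m : ℕ) :
    ∃ net : Network d r,
      (∀ᵐ x ∂(cubeMeasure d), |f x - net.eval relu x| ≤ (B + 1) * d ^ s * (2 / n) ^ s +
        (n + 1) ^ d * Fintype.card (MonomialIndex d s) * ((B + 1) * ((d + s) * (1 / 4 ^ m)))) ∧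
      net.paramCount ≤
        ((n + 1) ^ d * Fintype.card (MonomialIndex d s) * ((d + s) * (9 * m + 13) + 3) + 1) *
          (1 + 2 * (d + (9 + r)) * r + (d + (9 + r))) := by
  obtain ⟨c, hcb, hc⟩ := exists_local_polynomial hs hf hB
  set L : List (ℝ × List (Factor d)) :=
    (Finset.univ : Finset ((Fin d → Fin (n + 1)) × MonomialIndex d s)).toList.map (gridTerm n c)
    with hL
  have hlen : L.length = (n + 1) ^ d * Fintype.card (MonomialIndex d s) := by
    rw [hL, List.length_map, Finset.length_toList, Finset.card_univ, Fintype.card_prod]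
    simp
  obtain ⟨net, hnet, hcount⟩ := exists_network_of_terms hr m (d + s) L (by
    intro t ht
    obtain ⟨p, -, rfl⟩ := List.mem_map.mp ht
    exact length_gridTerm_le n c p)
  refine ⟨net, ?_, by rw [hlen] at hcount; exact hcount⟩
  have hmem : ∀ᵐ x ∂(cubeMeasure d), x ∈ (openCube d : Set (Fin d → ℝ)) :=
    ae_restrict_mem measurableSet_openCube
  filter_upwards [hc, hmem] with x hcx hxm
  have hx := openCube_subset_Icc hxm
  have h1 := abs_sub_sum_gridTerm_le hn hx (by positivity) hcx
  have h2 : net.eval relu x = ∑ p, termApprox m x (gridTerm n c p) := by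
    rw [hnet x hx, hL, List.map_map, Finset.sum_map_toList]
    rfl
  have h3 : |∑ p, (gridTerm n c p).1 * ((gridTerm n c p).2.map fun φ => φ.eval x).prod -
      ∑ p, termApprox m x (gridTerm n c p)| ≤
        (n + 1) ^ d * Fintype.card (MonomialIndex d s) * ((B + 1) * ((d + s) * (1 / 4 ^ m))) := by
    rw [← Finset.sum_sub_distrib]
    calc _ ≤ ∑ _p : (Fin d → Fin (n + 1)) × MonomialIndex d s,
          ((B : ℝ) + 1) * ((d + s) * (1 / 4 ^ m)) := by
          refine (Finset.abs_sum_le_sum_abs _ _).trans (Finset.sum_le_sum fun p _ => ?_)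
          rw [termApprox, ← mul_sub, abs_mul, abs_sub_comm]
          refine mul_le_mul (hcb _ (corner_mem hn _) _) ?_ (abs_nonneg _) (by positivity)
          refine (abs_prodApprox_sub_le m _ fun a ha => ?_).trans ?_
          · obtain ⟨φ, -, rfl⟩ := List.mem_map.mp ha
            exact φ.eval_mem x
          · rw [List.length_map]
            have := length_gridTerm_le n c p
            gcongr
            exact_mod_cast this
      _ = _ := by
          rw [Finset.sum_const, Finset.card_univ, Fintype.card_prod, nsmul_eq_mul]
          simp
  rw [h2]
  exact (abs_sub_le _ _ _).trans (add_le_add h1 h3)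

end GridApproximation

/-! ### Continuous representatives -/

section Continuity

variable {d r : ℕ}

theorem Network.continuous_eval (net : Network d r) : Continuous (net.eval relu) := by
  have haff : ∀ l : Layer net.width r, Continuous l.affine := fun l =>
    (Continuous.matrix_mulVec continuous_const continuous_id).add continuous_const
  have hrelu : Continuous relu := continuous_id.max continuous_const
  have hfold : ∀ (L : List (Layer net.width r)) (g : (Fin d → ℝ) → Fin net.width → ℝ),
      Continuous g →
        Continuous fun x => L.foldl (fun z l => fun i => relu (l.affine z i)) (g x) := by
    intro L
    induction L with
    | nil => exact fun g hg => hg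
    | cons l L ih =>
      intro g hg
      exact ih (fun x => fun i => relu (l.affine (g x) i)) (continuous_pi fun i =>
        hrelu.comp ((continuous_apply i).comp ((haff l).comp hg)))
  have hpad : Continuous (pad (d := d) net.width) := by
    refine continuous_pi fun i => ?_
    unfold pad
    split_ifs
    · exact continuous_apply _
    · exact continuous_const
  exact (continuous_apply _).comp ((haff _).comp (hfold _ _ hpad))

/-- An almost everywhere bound between continuous functions extends to the closed cube. -/
theorem forall_abs_sub_le_of_ae {f g : (Fin d → ℝ) → ℝ} {ε : ℝ}
    (h : ∀ᵐ x ∂(cubeMeasure d), |f x - g x| ≤ ε) (hg : Continuous g)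
    (hf : ContinuousOn f (Set.Icc 0 1)) : ∀ x ∈ Set.Icc (0 : Fin d → ℝ) 1, |f x - g x| ≤ ε := by
  have hcont : ContinuousOn (fun x => max (|f x - g x| - ε) 0) (Set.Icc 0 1) :=
    (((hf.sub hg.continuousOn).abs).sub continuousOn_const).sup continuousOn_const
  have hopen : Set.EqOn (fun x => max (|f x - g x| - ε) 0) (fun _ => 0)
      (openCube d : Set (Fin d → ℝ)) := by
    refine Measure.eqOn_open_of_ae_eq (μ := volume) ?_ (openCube d).isOpen
      (hcont.mono openCube_subset_Icc) continuousOn_const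
    filter_upwards [h] with x hx
    exact max_eq_right (by linarith)
  have hdense : Set.Icc (0 : Fin d → ℝ) 1 ⊆ closure (openCube d : Set (Fin d → ℝ)) := by
    intro x hx
    have : (openCube d : Set (Fin d → ℝ)) = Set.pi Set.univ fun _ => Set.Ioo (0 : ℝ) 1 := rfl
    rw [this, closure_pi_set]
    intro i _
    rw [closure_Ioo zero_ne_one]
    exact ⟨hx.1 i, hx.2 i⟩
  have hall := hopen.of_subset_closure hcont continuousOn_const openCube_subset_Icc hdense
  intro x hx
  have h1 : max (|f x - g x| - ε) 0 = 0 := hall hx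
  linarith [le_max_left (|f x - g x| - ε) 0]

end Continuity

/-! ### The choice of the grid and of the accuracy of the products -/

section Parameters

/-- Grids with `n ≈ ε^{-1/s}` cells per direction and `m ≈ log (1/ε)` steps in each product
approximate to within `ε`. -/
theorem exists_grid_parameters (d s : ℕ) (hs : 1 ≤ s) {A D : ℝ} (hA : 0 < A) (hD : 0 ≤ D) :
    ∃ K M : ℝ, 0 < K ∧ 0 < M ∧ ∀ ε : ℝ, 0 < ε → ε ≤ 1 / 2 → ∃ n m : ℕ, 1 ≤ n ∧
      A * (2 / n) ^ s + (n + 1) ^ d * (D * (1 / 4 ^ m)) ≤ ε ∧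
      ((n : ℝ) + 1) ^ d ≤ K * ε ^ (-(d : ℝ) / (s : ℝ)) ∧ (m : ℝ) ≤ M * Real.log (1 / ε) := by
  have hs0 : (0 : ℝ) < s := by exact_mod_cast hs
  set R : ℝ := (2 * A * 2 ^ s) ^ (1 / (s : ℝ)) with hR
  have hR0 : 0 < R := by positivity
  have hRs : R ^ s = 2 * A * 2 ^ s := by
    rw [hR, one_div, Real.rpow_inv_natCast_pow (by positivity) (by omega)]
  set K : ℝ := (R + 2) ^ d with hK
  have hK0 : 0 < K := by positivity
  set E : ℝ := 2 * K * D with hE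
  have hE0 : 0 ≤ E := by positivity
  refine ⟨K, 2 * (E + 1) + (d / s + 1), hK0, by positivity, fun ε hε hε2 => ?_⟩
  set l : ℝ := Real.log (1 / ε) with hl
  have hεl : ε = Real.exp (-l) := by
    rw [hl, one_div, Real.log_inv, neg_neg, Real.exp_log hε]
  have hl2 : 1 / 2 ≤ l := by
    have h1 : Real.log 2 ≤ l :=
      Real.log_le_log (by norm_num) (by rw [le_div_iff₀ hε]; linarith)
    linarith [Real.log_two_gt_d9]
  set X : ℝ := ε ^ (-1 / (s : ℝ)) with hX
  have hX1 : 1 ≤ X := Real.one_le_rpow_of_pos_of_le_one_of_nonpos hε (by linarith)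
    (div_nonpos_of_nonpos_of_nonneg (by norm_num) hs0.le)
  have hXs : X ^ s = 1 / ε := by
    rw [hX, ← Real.rpow_natCast, ← Real.rpow_mul hε.le, div_mul_cancel₀ _ hs0.ne',
      Real.rpow_neg_one, one_div]
  have hXd : X ^ d = ε ^ (-(d : ℝ) / (s : ℝ)) := by
    rw [hX, ← Real.rpow_natCast, ← Real.rpow_mul hε.le]
    congr 1
    ring
  set n : ℕ := ⌈R * X⌉₊ with hn
  have hRX : 0 < R * X := by positivity
  have hn1 : 1 ≤ n := Nat.ceil_pos.mpr hRX
  have hn0 : (0 : ℝ) < n := by exact_mod_cast hn1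
  have hnR : R * X ≤ n := Nat.le_ceil _
  have hnK : ((n : ℝ) + 1) ^ d ≤ K * X ^ d := by
    rw [hK, ← mul_pow]
    have h1 : (n : ℝ) < R * X + 1 := Nat.ceil_lt_add_one hRX.le
    gcongr
    nlinarith
  have hfirst : A * (2 / n) ^ s ≤ ε / 2 := by
    have h1 : 2 * A * 2 ^ s * (1 / ε) ≤ (n : ℝ) ^ s := by
      rw [← hRs, ← hXs, ← mul_pow]
      gcongr
    rw [div_pow, ← mul_div_assoc, div_le_iff₀ (by positivity)]
    have h2 : A * 2 ^ s = ε / 2 * (2 * A * 2 ^ s * (1 / ε)) := by field_simp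
    rw [h2]
    gcongr
  -- The summand `E` makes `4 ^ m` exceed the constant factor `E ≤ exp E` as well.
  set m : ℕ := ⌈E + (d / s + 1) * l⌉₊ with hm
  have hm0 : 0 ≤ E + (d / s + 1) * l := by positivity
  have hmle : E + (d / s + 1) * l ≤ m := Nat.le_ceil _
  have hmlt : (m : ℝ) < E + (d / s + 1) * l + 1 := Nat.ceil_lt_add_one hm0
  have hpow : E * X ^ d / ε ≤ 4 ^ m := by
    have h1 : X ^ d / ε = Real.exp ((d / s + 1) * l) := by
      rw [hXd, hεl, ← Real.exp_mul, ← Real.exp_sub]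
      congr 1
      ring
    calc E * X ^ d / ε = E * Real.exp ((d / s + 1) * l) := by rw [← h1, mul_div_assoc]
      _ ≤ Real.exp E * Real.exp ((d / s + 1) * l) := by
          gcongr
          linarith [Real.add_one_le_exp E]
      _ = Real.exp (E + (d / s + 1) * l) := (Real.exp_add _ _).symm
      _ ≤ Real.exp m := Real.exp_le_exp.mpr hmle
      _ = Real.exp 1 ^ m := by rw [← Real.exp_nat_mul, mul_one]
      _ ≤ 4 ^ m := by
          gcongr
          linarith [Real.exp_one_lt_d9]
  have hsecond : ((n : ℝ) + 1) ^ d * (D * (1 / 4 ^ m)) ≤ ε / 2 := by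
    calc ((n : ℝ) + 1) ^ d * (D * (1 / 4 ^ m)) ≤ K * X ^ d * (D * (1 / 4 ^ m)) := by gcongr
      _ = ε / 2 * ((E * X ^ d / ε) / 4 ^ m) := by rw [hE]; field_simp
      _ ≤ ε / 2 * 1 := by
          gcongr
          rw [div_le_one (by positivity)]
          exact hpow
      _ = ε / 2 := mul_one _
  refine ⟨n, m, hn1, by linarith, by rw [← hXd]; exact hnK, ?_⟩
  -- Constants are absorbed by `2 * l`, since `log 2 ≥ 1 / 2`.
  have h3 : E + 1 ≤ 2 * (E + 1) * l := by nlinarith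
  linarith [add_mul (2 * (E + 1)) ((d : ℝ) / s + 1) l]

end Parameters

end DLoR

end

theorem theorem5p4 (d s r : ℕ) (hd : 1 ≤ d) (hs : 1 ≤ s) (hr : 1 ≤ r) (B : ℝ≥0) :
    ∃ C : ℝ, 0 < C ∧
      ∀ f : (Fin d → ℝ) → ℝ, DLoR.MemSobolev s f → DLoR.sobolevNorm s f ≤ (B : ℝ≥0∞) →
        ∀ ε : ℝ, 0 < ε →
          ∃ net : DLoR.Network d r,
            (∀ᵐ x ∂(DLoR.cubeMeasure d), |f x - net.eval DLoR.relu x| ≤ ε) ∧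
            (ContinuousOn f (Set.Icc 0 1) →
              ∀ x ∈ Set.Icc (0 : Fin d → ℝ) 1, |f x - net.eval DLoR.relu x| ≤ ε) ∧
            (ε ≤ 1 / 2 →
              (net.paramCount : ℝ) ≤ C * ε ^ (-(d : ℝ) / (s : ℝ)) * Real.log (1 / ε)) := by
  have hd0 : (0 : ℝ) < d := by exact_mod_cast hd
  set Q : ℝ := ((Fintype.card (DLoR.MonomialIndex d s) : ℕ) : ℝ) with hQ
  have hQ0 : 0 ≤ Q := Nat.cast_nonneg _
  set W : ℝ := 1 + 2 * (d + (9 + r)) * r + (d + (9 + r)) with hW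
  have hW0 : 0 < W := by positivity
  obtain ⟨K, M, hK, hM, hpar⟩ := DLoR.exists_grid_parameters d s hs
    (A := (B + 1) * d ^ s) (D := Q * ((B + 1) * (d + s))) (by positivity) (by positivity)
  refine ⟨(K * Q * ((d + s) * (9 * M + 26) + 6) + 2) * W, by positivity, fun f hf hB ε hε => ?_⟩
  obtain ⟨n, m, hn, herr, hnK, hmM⟩ := hpar (min ε (1 / 2)) (by positivity) (min_le_right _ _)
  obtain ⟨net, hnet, hcount⟩ := DLoR.exists_network_of_grid (r := r) hs hr hf hB hn m
  have hae : ∀ᵐ x ∂(DLoR.cubeMeasure d), |f x - net.eval DLoR.relu x| ≤ ε := by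
    filter_upwards [hnet] with x hx
    refine hx.trans (le_trans (le_of_eq ?_) (herr.trans (min_le_left _ _)))
    ring
  refine ⟨net, hae, DLoR.forall_abs_sub_le_of_ae hae net.continuous_eval, fun hε2 => ?_⟩
  rw [min_eq_left hε2] at hnK hmM
  set X : ℝ := ε ^ (-(d : ℝ) / (s : ℝ)) with hX
  set l : ℝ := Real.log (1 / ε) with hl
  have hX1 : 1 ≤ X := Real.one_le_rpow_of_pos_of_le_one_of_nonpos hε (by linarith)
    (div_nonpos_of_nonpos_of_nonneg (by linarith) (Nat.cast_nonneg s))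
  -- Constants are absorbed by `2 * l`, since `log 2 ≥ 1 / 2`.
  have hl2 : 1 ≤ 2 * l := by
    have h1 : Real.log 2 ≤ l :=
      Real.log_le_log (by norm_num) (by rw [le_div_iff₀ hε]; linarith)
    linarith [Real.log_two_gt_d9]
  have hl0 : 0 < l := by linarith
  calc (net.paramCount : ℝ)
      ≤ (((n : ℝ) + 1) ^ d * Q * ((d + s) * (9 * m + 13) + 3) + 1) * W := by
        rw [hQ, hW]
        exact_mod_cast hcount
    _ ≤ (K * X * Q * ((d + s) * (9 * (M * l) + 13 * (2 * l)) + 3 * (2 * l)) + X * (2 * l)) * W := by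
        have h13 : (13 : ℝ) ≤ 13 * (2 * l) := by linarith
        have h3 : (3 : ℝ) ≤ 3 * (2 * l) := by linarith
        have h1 : (1 : ℝ) ≤ X * (2 * l) := one_le_mul_of_one_le_of_one_le hX1 hl2
        gcongr
    _ = (K * Q * ((d + s) * (9 * M + 26) + 6) + 2) * W * X * l := by ring
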